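/- **Conventions.** Let $\varphi_e$ be the $e$-th partial computable function and $W_e=\operatorname{dom}\varphi_e$; an index of a total function $g:\mathbb N\to\mathbb N$ is an $e$ with $\varphi_e=g$. Fix effective enumerations of $\mathbb Q$ and of the (nondegenerate, bounded) open intervals $I_i$ with rational endpoints, and use them to code rationals, intervals and finite lists of intervals by natural numbers. - A *name* of $x\in\mathbb R$ is a sequence $(q_n)$ of rationals with $q_n\to x$ and $|q_n-q_{n+1}|<2^{-n}$ for all $n$. An index of $x$ is an index of a computable name of $x$. - An index of a function $f:\mathbb R\to\mathbb R$ is an index of a Turing functional that maps every name of every $x\in\mathbb R$ to a name of $f(x)$; $f$ is *computable* if it has an index. - A *name* of $f\in C(\mathbb R)$ is an enumeration of all pairs $(I,J)$, $I$ a compact and $J$ an open (nondegenerate, bounded) interval with rational endpoints, such that $f(I)\subseteq J$. - A *name* of a compact set $K\subseteq\mathbb R$ is an enumeration of all finite lists of rational open intervals that cover $K$ and each of whose members meets $K$. An index of $K$ is an index of a computable name of $K$. - An index of a $\Sigma^0_1$ open set $U\subseteq\mathbb R$ is an $e$ with $W_e=\{i: I_i\subseteq U\}$. - A sequence $(\mu_n)$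 of finite Borel measures on $\mathbb R$ is *uniformly computable* if an index of the real $\mu_n(\mathbb R)$ can be computed from $n$, and an index (as a c.e. set) of the left Dedekind cut $\{q\in\mathbb Q:q<\mu_n(U)\}$ can be computed from $n$ and an index of the $\Sigma^0_1$ set $U$. - A *modulus of convergence* of a real sequence $(a_n)$ to $a$ is a function $g:\mathbb N\to\mathbb N$ with $|a_n-a|<2^{-k}$ whenever $n\ge g(k)$. $C_K(\mathbb R)$ is the set of compactly supported continuous functions $\mathbb R\to\mathbb R$, and $\operatorname{supp}f$ is the closure of $\{f\neq0\}$. Let $\mu$ be a locally finite Borel measure on $\mathbb R$. - $(\mu_n)$ *effectively vaguely converges* to $\mu$ if $\int f\,d\mu_n\to\int f\,d\mu$ for every computable $f\in C_K(\mathbb R)$, and there is a partial computable function which, for every such $f$, maps any index of $f$ together with any index of $\operatorname{supp} f$ to an index of a modulus of convergence of $(\int f\,d\mu_n)_n$ to $\int f\,d\mu$. - $(\mu_n)$ *uniformly effectively vaguely converges* to $\mu$ if $\int f\,d\mu_n\to\int f\,d\mu$ for every $f\in C_K(\mathbb R)$, and there is one Turing functional which, for every $f\in C_K(\mathbb R)$,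 computes from any name of $f$ and any name of $\operatorname{supp}f$ a modulus of convergence of $(\int f\,d\mu_n)_n$ to $\int f\,d\mu$. **Theorem.** Let $(\mu_n)_{n\in\mathbb N}$ be a uniformly computable sequence of finite Borel measures on $\mathbb R$. For every locally finite Borel measure $\mu$ on $\mathbb R$, $(\mu_n)$ effectively vaguely converges to $\mu$ if and only if $(\mu_n)$ uniformly effectively vaguely converges to $\mu$. In particular, $(\mu_n)$ is effectively vaguely convergent if and only if it is uniformly effectively vaguely convergent. -/

import Mathlib

open MeasureTheory Filter Topology

noncomputable section

namespace EffVague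

/-! ### Indices of partial computable functions, c.e. sets and Turing functionals -/

/-- The `e`-th partial computable function `ℕ ⇀ ℕ`. -/
def phi (e : ℕ) : ℕ →. ℕ := (Denumerable.ofNat Nat.Partrec.Code e).eval

/-- The `e`-th c.e. set, the domain of `phi e`. -/
def W (e : ℕ) : Set ℕ := {n | (phi e n).Dom}

/-- `e` is an index of the (total, computable) function `g`. -/
def Indexes (e : ℕ) (g : ℕ → ℕ) : Prop := ∀ n, g n ∈ phi e n

/-- The code of the initial segment `ρ 0, …, ρ (k - 1)` of `ρ`. -/
def initSeg (ρ : ℕ → ℕ) (k : ℕ) : ℕ := Encodable.encode ((List.range k).map ρ)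

/-- The `e`-th Turing functional, with oracle `ρ`, outputs `v` on input `n`.
The program `phi e` is run on longer and longer initial segments of the oracle; the answer `0`
means that more of the oracle is needed, and the first answer that is not `0`, say `v + 1`, means
that the output is `v`. (So `phi e` is a partial computable associate in the sense of Kleene; the
functionals obtained are exactly those computed by oracle Turing machines.) -/
def FunctionalOutputs (e : ℕ) (ρ : ℕ → ℕ) (n v : ℕ) : Prop :=
  ∃ k, v + 1 ∈ phi e (Nat.pair (initSeg ρ k) n) ∧
    ∀ j < k, 0 ∈ phi e (Nat.pair (initSeg ρ j) n)

/-- The `e`-th Turing functional with oracle `ρ` computes the total function `g`. -/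
def FunctionalComputes (e : ℕ) (ρ g : ℕ → ℕ) : Prop := ∀ n, FunctionalOutputs e ρ n (g n)

/-- The join of two oracles, from which both can be computed, and conversely. -/
def join (ρ κ : ℕ → ℕ) : ℕ → ℕ := fun n => Nat.pair (ρ n) (κ n)

/-! ### Effective enumerations of the rationals and of the rational intervals -/

/-- An effective enumeration (with repetitions) of `ℚ`: `⟨⟨a, b⟩, d⟩ ↦ (a - b) / (d + 1)`. -/
def ratOf (n : ℕ) : ℚ :=
  ((n.unpair.1.unpair.1 : ℚ) - (n.unpair.1.unpair.2 : ℚ)) / ((n.unpair.2 : ℚ) + 1)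

/-- An effective enumeration (with repetitions) of the positive rationals. -/
def posRatOf (n : ℕ) : ℚ := ((n.unpair.1 : ℚ) + 1) / ((n.unpair.2 : ℚ) + 1)

/-- Left endpoint of the `i`-th rational interval. -/
def lo (i : ℕ) : ℚ := ratOf i.unpair.1

/-- Right endpoint of the `i`-th rational interval. -/
def hi (i : ℕ) : ℚ := lo i + posRatOf i.unpair.2

/-- The `i`-th (nonempty) rational open interval. -/
def openInt (i : ℕ) : Set ℝ := Set.Ioo (lo i : ℝ) (hi i : ℝ)

/-- The `i`-th (nondegenerate) rational compact interval. -/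
def compactInt (i : ℕ) : Set ℝ := Set.Icc (lo i : ℝ) (hi i : ℝ)

/-! ### Names and indices -/

/-- `ρ` is a Cauchy name of the real number `x`. -/
def IsRealName (ρ : ℕ → ℕ) (x : ℝ) : Prop :=
  Tendsto (fun n => (ratOf (ρ n) : ℝ)) atTop (𝓝 x) ∧
    ∀ n, |(ratOf (ρ n) : ℝ) - (ratOf (ρ (n + 1)) : ℝ)| < (2 : ℝ)⁻¹ ^ n

/-- `e` is an index of the computable real `x`. -/
def IndexesReal (e : ℕ) (x : ℝ) : Prop := ∃ ρ, Indexes e ρ ∧ IsRealName ρ x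

/-- `e` is an index of a computable function `f`: the `e`-th Turing functional sends every name of
every `x` to a name of `f x`. -/
def IndexesFun (e : ℕ) (f : ℝ → ℝ) : Prop :=
  ∀ (x : ℝ) (ρ : ℕ → ℕ), IsRealName ρ x → ∃ σ, FunctionalComputes e ρ σ ∧ IsRealName σ (f x)

/-- `ρ` is a compact-open name of `f`: it enumerates all pairs `(I, J)`, with `I` a compact and `J`
an open rational interval, such that `f` maps `I` into `J`. -/
def IsFunName (ρ : ℕ → ℕ) (f : ℝ → ℝ) : Prop :=
  Set.range ρ = {c | f '' compactInt c.unpair.1 ⊆ openInt c.unpair.2}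

/-- The finite list `L` of rational open intervals is a minimal cover of `K`: it covers `K`, and
each of its members meets `K`. -/
def IsMinCover (L : List ℕ) (K : Set ℝ) : Prop :=
  (K ⊆ ⋃ i ∈ L, openInt i) ∧ ∀ i ∈ L, (openInt i ∩ K).Nonempty

/-- `κ` is a (minimal cover) name of the compact set `K`: it enumerates all minimal finite covers
of `K` by rational open intervals. -/
def IsCompactName (κ : ℕ → ℕ) (K : Set ℝ) : Prop :=
  Set.range κ = {c | IsMinCover (Denumerable.ofNat (List ℕ) c) K}

/-- `e` is an index of the computably compact set `K`. -/
def IndexesCompact (e : ℕ) (K : Set ℝ) : Prop := ∃ κ, Indexes e κ ∧ IsCompactName κ K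

/-- `e` is an index of the open set `U` as a `Σ⁰₁` set. -/
def IndexesOpen (e : ℕ) (U : Set ℝ) : Prop := IsOpen U ∧ W e = {i | openInt i ⊆ U}

/-- `e` is an index of the left Dedekind cut of `x`. -/
def IndexesLeftCut (e : ℕ) (x : ℝ) : Prop := W e = {i | (ratOf i : ℝ) < x}

/-! ### Computable measures and effective vague convergence -/

/-- The (finite) measures `μ n` are computable measures uniformly in `n`: an index of the real
`μ n ℝ` can be computed from `n`, and an index of the left Dedekind cut of `μ n U` can be computed
from `n` and an index of the `Σ⁰₁` set `U`. -/
def UniformlyComputable (μ : ℕ → Measure ℝ) : Prop :=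
  (∃ P : ℕ →. ℕ, Nat.Partrec P ∧ ∀ n, ∃ a ∈ P n, IndexesReal a ((μ n).real Set.univ)) ∧
  (∃ Q : ℕ →. ℕ, Nat.Partrec Q ∧ ∀ (n e : ℕ) (U : Set ℝ), IndexesOpen e U →
    ∃ c ∈ Q (Nat.pair n e), IndexesLeftCut c ((μ n).real U))

/-- `g` is a modulus of convergence of the sequence `a` to `l`. -/
def IsModulus (g : ℕ → ℕ) (a : ℕ → ℝ) (l : ℝ) : Prop :=
  ∀ k n, g k ≤ n → |a n - l| < (2 : ℝ)⁻¹ ^ k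

/-- `e` is an index of a modulus of convergence of `a` to `l`. -/
def IndexesModulus (e : ℕ) (a : ℕ → ℝ) (l : ℝ) : Prop := ∃ g, Indexes e g ∧ IsModulus g a l

/-- Vague convergence of measures on `ℝ`. -/
def VagueTendsto (μ : ℕ → Measure ℝ) (ν : Measure ℝ) : Prop :=
  ∀ f : ℝ → ℝ, Continuous f → HasCompactSupport f →
    Tendsto (fun n => ∫ x, f x ∂(μ n)) atTop (𝓝 (∫ x, f x ∂ν))

/-- Effective vague convergence: the integrals of every computable compactly supported continuous
`f` converge, and an index of a modulus of convergence can be computed from an index of `f` and an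
index of the support of `f`. -/
def EffectiveVagueTendsto (μ : ℕ → Measure ℝ) (ν : Measure ℝ) : Prop :=
  (∀ f : ℝ → ℝ, Continuous f → HasCompactSupport f → (∃ e, IndexesFun e f) →
    Tendsto (fun n => ∫ x, f x ∂(μ n)) atTop (𝓝 (∫ x, f x ∂ν))) ∧
  ∃ P : ℕ →. ℕ, Nat.Partrec P ∧
    ∀ (f : ℝ → ℝ) (e k : ℕ), Continuous f → HasCompactSupport f →
      IndexesFun e f → IndexesCompact k (tsupport f) →
      ∃ m ∈ P (Nat.pair e k), IndexesModulus m (fun n => ∫ x, f x ∂(μ n)) (∫ x, f x ∂ν)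

/-- Uniform effective vague convergence: vague convergence, and a single Turing functional computes,
for every compactly supported continuous `f`, a modulus of convergence of the integrals from any
name of `f` and any name of the support of `f`. -/
def UniformEffectiveVagueTendsto (μ : ℕ → Measure ℝ) (ν : Measure ℝ) : Prop :=
  VagueTendsto μ ν ∧
  ∃ e : ℕ, ∀ f : ℝ → ℝ, Continuous f → HasCompactSupport f →
    ∀ ρ κ : ℕ → ℕ, IsFunName ρ f → IsCompactName κ (tsupport f) →
      ∃ g, FunctionalComputes e (join ρ κ) g ∧
        IsModulus g (fun n => ∫ x, f x ∂(μ n)) (∫ x, f x ∂ν)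

end EffVague

end

namespace EffVague

/-! ### Primitive recursive functions and predicates -/

section Primrec

attribute [fun_prop] Primrec Primrec.id Primrec.const Primrec.comp Primrec.pair

variable {α β γ : Type*} [Primcodable α] [Primcodable β] [Primcodable γ]

/-! From uniform to effective, only computability of names matters. For `f` with a known index, "`f`
maps the compact interval `I` into the open interval `J`" is semidecidable. By compactness `I`
splits into finitely many cells, each carrying a finite prefix of a name, valid for every point of
the cell, on which the functional already outputs an approximation forcing the values into `J`.
Hence an index of `f` yields an index of a compact-open name (`exists_funName_index`), and running
the uniform functional on computable oracles is an effective operation (`exists_run_index`).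

From effective to uniform, the hypothesis speaks only of computable functions, so it is applied to
one countable family: tent functions with rational apex and slope `N + 1`. They and their supports
have indices computable from the parameters, so their moduli form a single computable function
(`exists_tent_modulus`). A name of the support of an arbitrary `f` bounds it within `[-M, M]`, and a
name of `f` eventually reveals an `N` and values `c i` such that `f` is close to `c i` on the
support of the `i`-th tent (`exists_fineAt`). Since the tents form a partition of unity on `[-M,
M]`, the integral of `f` is close to a linear combination of tent integrals, whose convergence is
controlled.

The tolerance must be fixed before `N` is known, so it needs a bound, independent of `N`, on the
mass near `[-M, M]` under the limit and all late `μ n`. The fine tents are dominated by the unit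
tents (`sum_tent_le`), whose integrals are bounded by the total mass of `μ n` at one computable time
plus a constant (`startTime_bounds`).

Convergence for every continuous compactly supported `f` comes for free, because every such `f` and
its support have names. -/

@[fun_prop] theorem primrec_add {f g : α → ℕ} (hf : Primrec f) (hg : Primrec g) :
    Primrec fun a => f a + g a := Primrec.nat_add.comp hf hg

@[fun_prop] theorem primrec_mul {f g : α → ℕ} (hf : Primrec f) (hg : Primrec g) :
    Primrec fun a => f a * g a := Primrec.nat_mul.comp hf hg

@[fun_prop] theorem primrec_sub {f g : α → ℕ} (hf : Primrec f) (hg : Primrec g) :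
    Primrec fun a => f a - g a := Primrec.nat_sub.comp hf hg

@[fun_prop] theorem primrec_pow {f g : α → ℕ} (hf : Primrec f) (hg : Primrec g) :
    Primrec fun a => f a ^ g a := (Primrec₂.unpaired'.1 Nat.Primrec.pow).comp hf hg

@[fun_prop] theorem primrec_natPair {f g : α → ℕ} (hf : Primrec f) (hg : Primrec g) :
    Primrec fun a => Nat.pair (f a) (g a) := Primrec₂.natPair.comp hf hg

@[fun_prop] theorem primrec_fst {f : α → β × γ} (hf : Primrec f) :
    Primrec fun a => (f a).1 := Primrec.fst.comp hf

@[fun_prop] theorem primrec_snd {f : α → β × γ} (hf : Primrec f) :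
    Primrec fun a => (f a).2 := Primrec.snd.comp hf

@[fun_prop] theorem primrec_unpair {f : α → ℕ} (hf : Primrec f) :
    Primrec fun a => Nat.unpair (f a) := Primrec.unpair.comp hf

@[fun_prop] theorem primrec_length {f : α → List β} (hf : Primrec f) :
    Primrec fun a => (f a).length := Primrec.list_length.comp hf

@[fun_prop] theorem primrec_getD {f : α → List β} {g : α → ℕ} {d : β} (hf : Primrec f)
    (hg : Primrec g) : Primrec fun a => (f a).getD (g a) d := (Primrec.list_getD d).comp hf hg

@[fun_prop] theorem primrec_take {f : α → List β} {g : α → ℕ} (hf : Primrec f)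
    (hg : Primrec g) : Primrec fun a => (f a).take (g a) := Primrec.list_take.comp hg hf

@[fun_prop] theorem primrec_encode {f : α → β} (hf : Primrec f) :
    Primrec fun a => Encodable.encode (f a) := Primrec.encode.comp hf

theorem primrec_ofNat_list : Primrec (Denumerable.ofNat (List ℕ)) := by
  have h : Primrec fun n => (Encodable.decode (α := List ℕ) n).getD [] :=
    Primrec.option_getD.comp Primrec.decode (Primrec.const _)
  refine h.of_eq fun n => ?_
  rw [Denumerable.decode_eq_ofNat]
  rfl

@[fun_prop] theorem primrec_listOf {f : α → ℕ} (hf : Primrec f) :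
    Primrec fun a => Denumerable.ofNat (List ℕ) (f a) := primrec_ofNat_list.comp hf

@[fun_prop] theorem primrec_codeOf {f : α → ℕ} (hf : Primrec f) :
    Primrec fun a => Denumerable.ofNat Nat.Partrec.Code (f a) := (Primrec.ofNat _).comp hf

@[fun_prop] theorem primrec_evaln_comp {f g : α → ℕ} {c : α → Nat.Partrec.Code}
    (hf : Primrec f) (hc : Primrec c) (hg : Primrec g) :
    Primrec fun a => Nat.Partrec.Code.evaln (f a) (c a) (g a) :=
  Nat.Partrec.Code.primrec_evaln.comp ((hf.pair hc).pair hg)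

theorem primrecPred_lt {f g : α → ℕ} (hf : Primrec f) (hg : Primrec g) :
    PrimrecPred fun a => f a < g a := Primrec.nat_lt.comp hf hg

theorem primrecPred_le {f g : α → ℕ} (hf : Primrec f) (hg : Primrec g) :
    PrimrecPred fun a => f a ≤ g a := Primrec.nat_le.comp hf hg

theorem primrecPred_mem_option {f : α → Option ℕ} {g : α → ℕ} (hf : Primrec f) (hg : Primrec g) :
    PrimrecPred fun a => g a ∈ f a :=
  (Primrec.eq.comp hf (Primrec.option_some.comp hg)).of_eq fun _ => Iff.rfl

theorem primrecPred_forall_lt {f : α → ℕ} {R : α → ℕ → Prop} (hf : Primrec f)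
    (hR : PrimrecPred fun q : α × ℕ => R q.1 q.2) :
    PrimrecPred fun a => ∀ j < f a, R a j := by
  have h : PrimrecRel fun (j : ℕ) (a : α) => R a j :=
    hR.comp (Primrec.snd.pair Primrec.fst)
  exact (h.forall_mem_list.comp (Primrec.list_range.comp hf) Primrec.id).of_eq (by simp)

theorem primrecPred_exists_lt {f : α → ℕ} {R : α → ℕ → Prop} (hf : Primrec f)
    (hR : PrimrecPred fun q : α × ℕ => R q.1 q.2) :
    PrimrecPred fun a => ∃ j < f a, R a j := by
  have h : PrimrecRel fun (j : ℕ) (a : α) => R a j :=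
    hR.comp (Primrec.snd.pair Primrec.fst)
  exact (h.exists_mem_list.comp (Primrec.list_range.comp hf) Primrec.id).of_eq (by simp)

theorem primrecPred_forall_mem {f : α → List β} {R : α → β → Prop} (hf : Primrec f)
    (hR : PrimrecPred fun q : α × β => R q.1 q.2) :
    PrimrecPred fun a => ∀ j ∈ f a, R a j := by
  have h : PrimrecRel fun (j : β) (a : α) => R a j :=
    hR.comp (Primrec.snd.pair Primrec.fst)
  exact h.forall_mem_list.comp hf Primrec.id

theorem primrecPred_exists_mem {f : α → List β} {R : α → β → Prop} (hf : Primrec f)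
    (hR : PrimrecPred fun q : α × β => R q.1 q.2) :
    PrimrecPred fun a => ∃ j ∈ f a, R a j := by
  have h : PrimrecRel fun (j : β) (a : α) => R a j :=
    hR.comp (Primrec.snd.pair Primrec.fst)
  exact h.exists_mem_list.comp hf Primrec.id

end Primrec

/-! ### Indices by parametrization -/

/-- The s-m-n theorem: currying a code is primitive recursive. -/
theorem exists_index_param {F : ℕ → ℕ →. ℕ} (hF : Partrec₂ F) :
    ∃ h : ℕ → ℕ, Primrec h ∧ ∀ p n, phi (h p) n = F p n := by
  obtain ⟨c, hc⟩ := Nat.Partrec.Code.exists_code.1 (Partrec₂.unpaired'.2 hF)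
  refine ⟨fun p => Encodable.encode (Nat.Partrec.Code.curry c p),
    Primrec.encode.comp (Nat.Partrec.Code.primrec₂_curry.comp (Primrec.const c) Primrec.id), ?_⟩
  intro p n
  simp [phi, Nat.Partrec.Code.eval_curry, hc, Nat.unpaired]

theorem partrec₂_phi : Partrec₂ phi :=
  Nat.Partrec.Code.eval_part.comp ((Computable.ofNat _).comp Computable.fst) Computable.snd

theorem partrec₂_search {T : ℕ × ℕ → ℕ → Bool} {v : ℕ × ℕ → ℕ → ℕ} (hT : Primrec₂ T)
    (hv : Primrec₂ v) :
    Partrec₂ fun p n => (Nat.rfind fun m => (T (p, n) m : Part Bool)).map (v (p, n)) := by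
  have h : Partrec fun q : ℕ × ℕ => (Nat.rfind fun m => (T q m : Part Bool)).map (v q) :=
    (Partrec.rfind hT.to_comp.partrec₂).map hv.to_comp
  exact h.to₂

/-- A semidecidable family of nonempty sets is uniformly computably enumerated. -/
theorem exists_enumeration {R : ℕ → ℕ → ℕ → Prop}
    (hR : PrimrecPred fun a : ℕ × ℕ × ℕ => R a.1 a.2.1 a.2.2) :
    ∃ h : ℕ → ℕ, Primrec h ∧ ∀ p, (∃ c t, R p c t) →
      ∃ r, Indexes (h p) r ∧ Set.range r = {c | ∃ t, R p c t} := by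
  classical
  -- Input `n` is first tried itself as a code of a pair `(c, t)`, then `0, 1, 2, …` are tried. So
  -- every valid pair gets its turn, while invalid inputs fall back on some valid one and the
  -- enumeration is total.
  let cand : ℕ → ℕ → ℕ := fun n m => if m = 0 then n else m - 1
  have hcand : Primrec fun a : ℕ × ℕ => cand a.1 a.2 :=
    Primrec.ite (Primrec.eq.comp Primrec.snd (Primrec.const 0)) Primrec.fst (by fun_prop)
  let test : ℕ × ℕ → ℕ → Bool := fun q m =>
    decide (R q.1 (cand q.2 m).unpair.1 (cand q.2 m).unpair.2)
  have htest : Primrec₂ test := by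
    have h : PrimrecPred fun a : (ℕ × ℕ) × ℕ =>
        R a.1.1 (cand a.1.2 a.2).unpair.1 (cand a.1.2 a.2).unpair.2 := by
      have hc : Primrec fun a : (ℕ × ℕ) × ℕ => cand a.1.2 a.2 :=
        hcand.comp (Primrec.pair (by fun_prop) (by fun_prop))
      exact hR.comp (f := fun a : (ℕ × ℕ) × ℕ => (a.1.1, (cand a.1.2 a.2).unpair.1,
        (cand a.1.2 a.2).unpair.2)) (by fun_prop)
    exact h.decide
  have hval : Primrec₂ fun (q : ℕ × ℕ) (m : ℕ) => (cand q.2 m).unpair.1 := by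
    have hc : Primrec fun a : (ℕ × ℕ) × ℕ => cand a.1.2 a.2 :=
      hcand.comp (Primrec.pair (by fun_prop) (by fun_prop))
    exact primrec_fst (primrec_unpair hc)
  have hF := partrec₂_search htest hval
  obtain ⟨h, hh, hphi⟩ := exists_index_param hF
  refine ⟨h, hh, fun p ⟨c₀, t₀, hct⟩ => ?_⟩
  have hdom : ∀ n, ∃ v, v ∈ phi (h p) n := by
    intro n
    have h0 : test (p, n) (Nat.pair c₀ t₀ + 1) = true := by simp [test, cand, hct]
    obtain ⟨m, hm, -⟩ := Nat.rfind_min' (p := test (p, n)) h0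
    rw [hphi]
    exact ⟨_, Part.mem_map _ hm⟩
  choose r hr using hdom
  refine ⟨r, hr, ?_⟩
  simp only [hphi] at hr
  ext c
  constructor
  · rintro ⟨n, rfl⟩
    obtain ⟨m, hm, hv⟩ := (Part.mem_map_iff _).1 (hr n)
    have h1 : test (p, n) m = true := by simpa using Nat.rfind_spec hm
    refine ⟨(cand n m).unpair.2, ?_⟩
    rw [← hv]
    simpa [test] using h1
  · rintro ⟨t, ht⟩
    refine ⟨Nat.pair c t, ?_⟩
    obtain ⟨m, hm, hv⟩ := (Part.mem_map_iff _).1 (hr (Nat.pair c t))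
    have h0 : test (p, Nat.pair c t) 0 = true := by simp [test, cand, ht]
    have hm0 : m = 0 := by
      rcases Nat.eq_zero_or_pos m with h | h
      · exact h
      · have := Nat.rfind_min hm h
        simp [h0] at this
    rw [← hv, hm0]
    simp [cand]

/-- Total computable functions on oracle segments give Turing functionals, uniformly. -/
theorem exists_functional_param {F : ℕ → List ℕ → ℕ → ℕ}
    (hF : Computable fun a : ℕ × List ℕ × ℕ => F a.1 a.2.1 a.2.2) :
    ∃ h : ℕ → ℕ, Primrec h ∧ ∀ p ρ n v k, F p ((List.range k).map ρ) n = v + 1 →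
      (∀ j < k, F p ((List.range j).map ρ) n = 0) → FunctionalOutputs (h p) ρ n v := by
  let G : ℕ → ℕ →. ℕ := fun p m =>
    Part.some (F p (Denumerable.ofNat (List ℕ) m.unpair.1) m.unpair.2)
  have hG : Partrec₂ G := by
    have h1 : Primrec fun a : ℕ × ℕ =>
      (a.1, Denumerable.ofNat (List ℕ) a.2.unpair.1, a.2.unpair.2) := by fun_prop
    exact (hF.comp h1.to_comp).partrec
  obtain ⟨h, hh, hphi⟩ := exists_index_param hG
  refine ⟨h, hh, fun p ρ n v k hk hj => ⟨k, ?_, fun j hjk => ?_⟩⟩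
  · rw [hphi]
    simp [G, initSeg, hk]
  · rw [hphi]
    simp [G, initSeg, hj j hjk]

/-- Different stopping lengths would make the same answer both zero and positive. -/
theorem FunctionalOutputs.unique {e : ℕ} {ρ : ℕ → ℕ} {n v w : ℕ}
    (hv : FunctionalOutputs e ρ n v) (hw : FunctionalOutputs e ρ n w) : v = w := by
  obtain ⟨k, hk, hk'⟩ := hv
  obtain ⟨l, hl, hl'⟩ := hw
  rcases lt_trichotomy k l with h | rfl | h
  · exact absurd (Part.mem_unique hk (hl' k h)) (Nat.succ_ne_zero v)
  · exact Nat.succ_injective (Part.mem_unique hk hl)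
  · exact absurd (Part.mem_unique hl (hk' l h)) (Nat.succ_ne_zero w)

/-! ### Arithmetic on codes of rationals -/

/-- The code of `(a - b) / (d + 1)`. -/
def ratCode (a b d : ℕ) : ℕ := Nat.pair (Nat.pair a b) d

/-- Codes store the denominator minus one, whence the final `- 1` here and in `interpCode`. -/
def addCode (x y : ℕ) : ℕ :=
  ratCode (x.unpair.1.unpair.1 * (y.unpair.2 + 1) + y.unpair.1.unpair.1 * (x.unpair.2 + 1))
    (x.unpair.1.unpair.2 * (y.unpair.2 + 1) + y.unpair.1.unpair.2 * (x.unpair.2 + 1))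
    ((x.unpair.2 + 1) * (y.unpair.2 + 1) - 1)

def negCode (x : ℕ) : ℕ := ratCode x.unpair.1.unpair.2 x.unpair.1.unpair.1 x.unpair.2

/-- The `j`-th of the points dividing the interval between `x` and `y` into `t + 1` equal parts. -/
def interpCode (x y j t : ℕ) : ℕ :=
  ratCode ((t + 1 - j) * x.unpair.1.unpair.1 * (y.unpair.2 + 1) +
      j * y.unpair.1.unpair.1 * (x.unpair.2 + 1))
    ((t + 1 - j) * x.unpair.1.unpair.2 * (y.unpair.2 + 1) +
      j * y.unpair.1.unpair.2 * (x.unpair.2 + 1))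
    ((x.unpair.2 + 1) * (y.unpair.2 + 1) * (t + 1) - 1)

/-- Cross-multiplied, with the subtracted terms moved to the other side so that all arithmetic stays
in `ℕ`. -/
def LtCode (x y : ℕ) : Prop :=
  x.unpair.1.unpair.1 * (y.unpair.2 + 1) + y.unpair.1.unpair.2 * (x.unpair.2 + 1) <
    y.unpair.1.unpair.1 * (x.unpair.2 + 1) + x.unpair.1.unpair.2 * (y.unpair.2 + 1)

def hiCode (i : ℕ) : ℕ :=
  addCode i.unpair.1 (ratCode (i.unpair.2.unpair.1 + 1) 0 i.unpair.2.unpair.2)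

@[simp] theorem ratOf_ratCode (a b d : ℕ) :
    ratOf (ratCode a b d) = ((a : ℚ) - b) / (d + 1) := by simp [ratOf, ratCode]

theorem ratOf_addCode (x y : ℕ) : ratOf (addCode x y) = ratOf x + ratOf y := by
  have h : 1 ≤ (x.unpair.2 + 1) * (y.unpair.2 + 1) := Nat.mul_pos (by simp) (by simp)
  rw [addCode, ratOf_ratCode, ratOf, ratOf]
  push_cast [Nat.cast_sub h]
  field_simp
  ring

theorem ratOf_negCode (x : ℕ) : ratOf (negCode x) = -ratOf x := by
  rw [negCode, ratOf_ratCode, ratOf]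
  ring

theorem ratOf_interpCode (x y j t : ℕ) (hj : j ≤ t + 1) :
    ratOf (interpCode x y j t) = ((t + 1 - j) * ratOf x + j * ratOf y) / (t + 1) := by
  have h : 1 ≤ (x.unpair.2 + 1) * (y.unpair.2 + 1) * (t + 1) :=
    Nat.mul_pos (Nat.mul_pos (by simp) (by simp)) (by simp)
  rw [interpCode, ratOf_ratCode, ratOf, ratOf]
  push_cast [Nat.cast_sub h, Nat.cast_sub hj]
  field_simp
  ring

theorem ltCode_iff (x y : ℕ) : LtCode x y ↔ ratOf x < ratOf y := by
  rw [LtCode, ratOf, ratOf, div_lt_div_iff₀ (by positivity) (by positivity),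
    ← Nat.cast_lt (α := ℚ)]
  push_cast
  constructor <;> intro h <;> linarith

theorem ltCode_iff_real (x y : ℕ) : LtCode x y ↔ (ratOf x : ℝ) < ratOf y := by
  rw [ltCode_iff, Rat.cast_lt]

theorem ratOf_hiCode (i : ℕ) : ratOf (hiCode i) = hi i := by
  rw [hiCode, ratOf_addCode, ratOf_ratCode, hi, lo, posRatOf]
  simp

theorem lo_lt_hi (i : ℕ) : lo i < hi i := by
  have : 0 < posRatOf i.unpair.2 := by unfold posRatOf; positivity
  unfold hi
  linarith

theorem exists_ratOf_eq (q : ℚ) : ∃ c, ratOf c = q := by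
  refine ⟨ratCode q.num.toNat (-q.num).toNat (q.den - 1), ?_⟩
  have h1 : ((q.num.toNat : ℤ) - ((-q.num).toNat : ℤ)) = q.num := by omega
  have h2 : ((q.num.toNat : ℚ) - ((-q.num).toNat : ℚ)) = q.num := by exact_mod_cast h1
  have h3 : ((q.den - 1 : ℕ) : ℚ) + 1 = q.den := by
    exact_mod_cast Nat.sub_add_cancel q.den_pos
  rw [ratOf_ratCode, h2, h3, Rat.num_div_den]

theorem exists_lo_hi_eq {x y : ℚ} (hxy : x < y) : ∃ i, lo i = x ∧ hi i = y := by
  obtain ⟨c, hc⟩ := exists_ratOf_eq x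
  have hpos : 0 < (y - x).num := Rat.num_pos.2 (sub_pos.2 hxy)
  have hden := (y - x).den_pos
  refine ⟨Nat.pair c (Nat.pair ((y - x).num.toNat - 1) ((y - x).den - 1)), ?_, ?_⟩
  · simp [lo, hc]
  · have h1 : (((y - x).num.toNat - 1 : ℕ) : ℚ) + 1 = (y - x).num := by
      have : (((y - x).num.toNat - 1 : ℕ) : ℤ) + 1 = (y - x).num := by omega
      exact_mod_cast this
    have h3 : (((y - x).den - 1 : ℕ) : ℚ) + 1 = (y - x).den := by
      exact_mod_cast Nat.sub_add_cancel hden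
    simp only [hi, lo, posRatOf, Nat.unpair_pair, hc, h1, h3, Rat.num_div_den]
    ring

theorem exists_ratOf_near (x : ℝ) {ε : ℝ} (hε : 0 < ε) : ∃ c, |(ratOf c : ℝ) - x| < ε := by
  obtain ⟨q, hq1, hq2⟩ := exists_rat_btwn (show x - ε < x + ε by linarith)
  obtain ⟨c, rfl⟩ := exists_ratOf_eq q
  exact ⟨c, abs_lt.2 ⟨by linarith, by linarith⟩⟩

/-- Components of a pair do not exceed its code. This crude bound lets magnitudes be read off
directly from codes. -/
theorem abs_ratOf_le (c : ℕ) : |(ratOf c : ℝ)| ≤ c := by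
  have h1 := Nat.unpair_left_le c.unpair.1
  have h2 := Nat.unpair_right_le c.unpair.1
  have h3 := Nat.unpair_left_le c
  have h1' : (c.unpair.1.unpair.1 : ℝ) ≤ c := by exact_mod_cast h1.trans h3
  have h2' : (c.unpair.1.unpair.2 : ℝ) ≤ c := by exact_mod_cast h2.trans h3
  have h4 : (0 : ℝ) ≤ c.unpair.1.unpair.1 := by positivity
  have h5 : (0 : ℝ) ≤ c.unpair.1.unpair.2 := by positivity
  rw [ratOf]
  push_cast
  rw [abs_div, abs_of_pos (by positivity : (0 : ℝ) < c.unpair.2 + 1)]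
  refine (div_le_self (abs_nonneg _) (by linarith [(by positivity : (0 : ℝ) ≤ c.unpair.2)])).trans ?_
  exact abs_le.2 ⟨by linarith, by linarith⟩

section Primrec

variable {α : Type*} [Primcodable α]

@[fun_prop] theorem primrec_ratCode {f g h : α → ℕ} (hf : Primrec f) (hg : Primrec g)
    (hh : Primrec h) : Primrec fun a => ratCode (f a) (g a) (h a) := by
  unfold ratCode; fun_prop

@[fun_prop] theorem primrec_addCode {f g : α → ℕ} (hf : Primrec f) (hg : Primrec g) :
    Primrec fun a => addCode (f a) (g a) := by unfold addCode; fun_prop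

@[fun_prop] theorem primrec_negCode {f : α → ℕ} (hf : Primrec f) :
    Primrec fun a => negCode (f a) := by unfold negCode; fun_prop

@[fun_prop] theorem primrec_hiCode {f : α → ℕ} (hf : Primrec f) :
    Primrec fun a => hiCode (f a) := by unfold hiCode; fun_prop

@[fun_prop] theorem primrec_interpCode {x y j t : α → ℕ} (hx : Primrec x) (hy : Primrec y)
    (hj : Primrec j) (ht : Primrec t) :
    Primrec fun a => interpCode (x a) (y a) (j a) (t a) := by unfold interpCode; fun_prop

theorem primrecPred_ltCode {f g : α → ℕ} (hf : Primrec f) (hg : Primrec g) :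
    PrimrecPred fun a => LtCode (f a) (g a) := by
  unfold LtCode
  exact primrecPred_lt (by fun_prop) (by fun_prop)

end Primrec

/-! ### Subdivisions -/

/-- Once the mesh is below a Lebesgue number of the cover, each cell lies in the ball around its
left endpoint. -/
theorem exists_subdivision {ι : Type*} {U : ι → Set ℝ} (hU : ∀ i, IsOpen (U i)) {x y : ℝ}
    (hxy : x ≤ y) (hc : Set.Icc x y ⊆ ⋃ i, U i) :
    ∃ t₀ : ℕ, ∀ t ≥ t₀, ∀ j < t + 1, ∃ i, Set.Icc (((t + 1 - j) * x + j * y) / (t + 1))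
      (((t + 1 - (j + 1 : ℕ)) * x + (j + 1 : ℕ) * y) / (t + 1)) ⊆ U i := by
  obtain ⟨δ, hδ, h⟩ := lebesgue_number_lemma_of_metric isCompact_Icc hU hc
  obtain ⟨t₀, ht₀⟩ := exists_nat_gt ((y - x) / δ)
  refine ⟨t₀, fun t htt j hj => ?_⟩
  have ht : (y - x) / δ < t := ht₀.trans_le (by exact_mod_cast htt)
  have ht1 : (0 : ℝ) < t + 1 := by positivity
  have hj' : (j : ℝ) + 1 ≤ t + 1 := by exact_mod_cast hj
  have hj0 : (0 : ℝ) ≤ j := by positivity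
  set p : ℝ := ((t + 1 - j) * x + j * y) / (t + 1) with hp
  have hp1 : p = x + j * ((y - x) / (t + 1)) := by rw [hp]; field_simp; ring
  have hstep : (((t : ℝ) + 1 - (j + 1 : ℕ)) * x + (j + 1 : ℕ) * y) / (t + 1)
      = p + (y - x) / (t + 1) := by
    rw [hp]; push_cast; field_simp; ring
  have hw0 : 0 ≤ (y - x) / (t + 1) := div_nonneg (by linarith) ht1.le
  have hwδ : (y - x) / (t + 1) < δ := by
    rw [div_lt_iff₀ hδ] at ht
    rw [div_lt_iff₀ ht1]
    nlinarith
  have hpI : p ∈ Set.Icc x y := by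
    refine ⟨by rw [hp1]; nlinarith, ?_⟩
    have h1 : (j : ℝ) * ((y - x) / (t + 1)) ≤ (t + 1) * ((y - x) / (t + 1)) :=
      mul_le_mul_of_nonneg_right (by linarith) hw0
    have h2 : ((t : ℝ) + 1) * ((y - x) / (t + 1)) = y - x := by field_simp
    rw [hp1]; linarith
  obtain ⟨i, hi⟩ := h p hpI
  refine ⟨i, fun z hz => hi ?_⟩
  rw [hstep] at hz
  rw [Metric.mem_ball, Real.dist_eq, abs_lt]
  constructor <;> linarith [hz.1, hz.2]

theorem exists_mem_subdivision {x y : ℝ} (t : ℕ) {z : ℝ} (hz : z ∈ Set.Icc x y) :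
    ∃ j < t + 1, z ∈ Set.Icc (((t + 1 - j) * x + j * y) / (t + 1))
      (((t + 1 - (j + 1 : ℕ)) * x + (j + 1 : ℕ) * y) / (t + 1)) := by
  have ht1 : (0 : ℝ) < t + 1 := by positivity
  -- The cell number is the floor of the rescaled position, except at the right endpoint, where that
  -- floor would be one too large.
  rcases hz.2.eq_or_lt with rfl | hlt
  · refine ⟨t, by simp, ?_, ?_⟩
    · rw [div_le_iff₀ ht1]; nlinarith [hz.1]
    · rw [le_div_iff₀ ht1]; push_cast; nlinarith [hz.1]
  · have hxy : 0 < y - x := by linarith [hz.1]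
    have hnn : 0 ≤ (z - x) / (y - x) * (t + 1) :=
      mul_nonneg (div_nonneg (by linarith [hz.1]) hxy.le) ht1.le
    have h1 := Nat.floor_le hnn
    have h2 := Nat.lt_floor_add_one ((z - x) / (y - x) * (t + 1))
    have hzz : (z - x) / (y - x) * (t + 1) * (y - x) = (z - x) * (t + 1) := by
      field_simp
    refine ⟨⌊(z - x) / (y - x) * (t + 1)⌋₊, ?_, ?_, ?_⟩
    · rw [Nat.floor_lt hnn]
      push_cast
      have : (z - x) / (y - x) < 1 := by rw [div_lt_one hxy]; linarith
      nlinarith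
    · rw [div_le_iff₀ ht1]; nlinarith
    · rw [le_div_iff₀ ht1]; push_cast; nlinarith

/-! ### Names of real numbers -/

theorem IsRealName.abs_sub_le {ρ : ℕ → ℕ} {x : ℝ} (h : IsRealName ρ x) (n : ℕ) :
    |(ratOf (ρ n) : ℝ) - x| ≤ 2 / 2 ^ n := by
  have := dist_le_of_le_geometric_two_of_tendsto (C := 2) (f := fun n => (ratOf (ρ n) : ℝ)) (a := x)
    (fun n => ?_) h.1 n
  · rwa [Real.dist_eq] at this
  · rw [Real.dist_eq]
    refine (h.2 n).le.trans (le_of_eq ?_)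
    rw [inv_pow]
    ring

/-- Allows a finite prefix to be continued to a name of any nearby real. The tolerances leave room
at the junction, where `1/2 + 1/8 < 1`, and in the tail, where `1/4 + 1/8 < 1`, in units of the
permitted step. -/
theorem isRealName_of_prefix {ρ : ℕ → ℕ} {x : ℝ} (k : ℕ)
    (hpre : ∀ i, i + 1 < k → |(ratOf (ρ i) : ℝ) - ratOf (ρ (i + 1))| < (2 : ℝ)⁻¹ ^ i)
    (hlast : ∀ i, i + 1 = k → |(ratOf (ρ i) : ℝ) - x| < (2 : ℝ)⁻¹ ^ k)
    (htail : ∀ i, k ≤ i → |(ratOf (ρ i) : ℝ) - x| < (2 : ℝ)⁻¹ ^ (i + 2)) :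
    IsRealName ρ x := by
  constructor
  · rw [tendsto_iff_dist_tendsto_zero]
    refine squeeze_zero' (Eventually.of_forall fun _ => dist_nonneg)
      (eventually_atTop.2 ⟨k, fun i hi => ?_⟩)
      (tendsto_pow_atTop_nhds_zero_of_lt_one (r := (2 : ℝ)⁻¹) (by norm_num) (by norm_num))
    rw [Real.dist_eq]
    exact (htail i hi).le.trans (pow_le_pow_of_le_one (by norm_num) (by norm_num) (by omega))
  · intro i
    have hpos : (0 : ℝ) < 2⁻¹ ^ i := by positivity
    have e1 : (2 : ℝ)⁻¹ ^ (i + 1) = 2⁻¹ ^ i / 2 := by rw [pow_succ]; ring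
    have e2 : (2 : ℝ)⁻¹ ^ (i + 2) = 2⁻¹ ^ i / 4 := by rw [pow_add]; ring
    have e3 : (2 : ℝ)⁻¹ ^ (i + 1 + 2) = 2⁻¹ ^ i / 8 := by rw [pow_add, pow_succ]; ring
    rcases lt_trichotomy (i + 1) k with h | h | h
    · exact hpre i h
    · have h1 := abs_lt.1 (hlast i h)
      have h2 := abs_lt.1 (htail (i + 1) h.ge)
      rw [← h, e1] at h1
      rw [e3] at h2
      exact abs_lt.2 ⟨by linarith [h1.1, h2.2], by linarith [h1.2, h2.1]⟩
    · have h1 := abs_lt.1 (htail i (by omega))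
      have h2 := abs_lt.1 (htail (i + 1) (by omega))
      rw [e2] at h1
      rw [e3] at h2
      exact abs_lt.2 ⟨by linarith [h1.1, h2.2], by linarith [h1.2, h2.1]⟩

/-- The code of `1 / 2 ^ i`. -/
def halfPowCode (i : ℕ) : ℕ := ratCode 1 0 (2 ^ i - 1)

theorem ratOf_halfPowCode (i : ℕ) : (ratOf (halfPowCode i) : ℝ) = (2 : ℝ)⁻¹ ^ i := by
  have h : 1 ≤ 2 ^ i := Nat.one_le_two_pow
  rw [halfPowCode, ratOf_ratCode]
  push_cast [Nat.cast_sub h]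
  rw [inv_pow]
  simp

@[fun_prop] theorem primrec_halfPowCode {α : Type*} [Primcodable α] {f : α → ℕ}
    (hf : Primrec f) : Primrec fun a => halfPowCode (f a) := by unfold halfPowCode; fun_prop

/-- `|x - y| < z` for the rationals with codes `x`, `y`, `z`. -/
def DistLtCode (x y z : ℕ) : Prop := LtCode x (addCode y z) ∧ LtCode y (addCode x z)

theorem distLtCode_iff (x y z : ℕ) :
    DistLtCode x y z ↔ |(ratOf x : ℝ) - ratOf y| < ratOf z := by
  rw [DistLtCode, ltCode_iff_real, ltCode_iff_real, ratOf_addCode, ratOf_addCode, abs_lt]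
  push_cast
  constructor <;> rintro ⟨h1, h2⟩ <;> constructor <;> linarith

theorem primrecPred_distLtCode {α : Type*} [Primcodable α] {f g h : α → ℕ}
    (hf : Primrec f) (hg : Primrec g) (hh : Primrec h) :
    PrimrecPred fun a => DistLtCode (f a) (g a) (h a) :=
  (primrecPred_ltCode hf (by fun_prop)).and (primrecPred_ltCode hg (by fun_prop))

/-! ### From an index of a function to a name -/

/-- `c` codes a prefix of a name of every real in the interval between `l` and `r`, on which the
`e`-th functional is seen to output a `v` on input `n` within `T` steps, such that the values thus
approximated lie in the `J`-th open interval. -/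
def CellCert (e J l r T c : ℕ) : Prop :=
  (Denumerable.ofNat (List ℕ) c.unpair.1.unpair.1).length ≠ 0 ∧
  (∀ i < (Denumerable.ofNat (List ℕ) c.unpair.1.unpair.1).length - 1,
    DistLtCode ((Denumerable.ofNat (List ℕ) c.unpair.1.unpair.1).getD i 0)
      ((Denumerable.ofNat (List ℕ) c.unpair.1.unpair.1).getD (i + 1) 0) (halfPowCode i)) ∧
  LtCode (addCode ((Denumerable.ofNat (List ℕ) c.unpair.1.unpair.1).getD
      ((Denumerable.ofNat (List ℕ) c.unpair.1.unpair.1).length - 1) 0)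
      (negCode (halfPowCode (Denumerable.ofNat (List ℕ) c.unpair.1.unpair.1).length))) l ∧
  LtCode r (addCode ((Denumerable.ofNat (List ℕ) c.unpair.1.unpair.1).getD
      ((Denumerable.ofNat (List ℕ) c.unpair.1.unpair.1).length - 1) 0)
      (halfPowCode (Denumerable.ofNat (List ℕ) c.unpair.1.unpair.1).length)) ∧
  (∃ k < (Denumerable.ofNat (List ℕ) c.unpair.1.unpair.1).length + 1,
    c.unpair.2 + 1 ∈ Nat.Partrec.Code.evaln T (Denumerable.ofNat Nat.Partrec.Code e)
      (Nat.pair (Encodable.encode ((Denumerable.ofNat (List ℕ) c.unpair.1.unpair.1).take k))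
        c.unpair.1.unpair.2) ∧
    ∀ j < k, 0 ∈ Nat.Partrec.Code.evaln T (Denumerable.ofNat Nat.Partrec.Code e)
      (Nat.pair (Encodable.encode ((Denumerable.ofNat (List ℕ) c.unpair.1.unpair.1).take j))
        c.unpair.1.unpair.2)) ∧
  LtCode J.unpair.1 (addCode c.unpair.2
    (negCode (addCode (halfPowCode c.unpair.1.unpair.2) (halfPowCode c.unpair.1.unpair.2)))) ∧
  LtCode (addCode c.unpair.2
    (addCode (halfPowCode c.unpair.1.unpair.2) (halfPowCode c.unpair.1.unpair.2))) (hiCode J)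

theorem primrecPred_cellCert {α : Type*} [Primcodable α] {e J l r T c : α → ℕ}
    (he : Primrec e) (hJ : Primrec J) (hl : Primrec l) (hr : Primrec r) (hT : Primrec T)
    (hc : Primrec c) : PrimrecPred fun a => CellCert (e a) (J a) (l a) (r a) (T a) (c a) := by
  unfold CellCert
  refine .and (.not (Primrec.eq.comp (by fun_prop) (by fun_prop))) (.and ?_ (.and ?_ (.and ?_
    (.and ?_ (.and ?_ ?_)))))
  · exact primrecPred_forall_lt (by fun_prop)
      (primrecPred_distLtCode (by fun_prop) (by fun_prop) (by fun_prop))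
  · exact primrecPred_ltCode (by fun_prop) (by fun_prop)
  · exact primrecPred_ltCode (by fun_prop) (by fun_prop)
  · refine primrecPred_exists_lt (by fun_prop) (.and ?_ ?_)
    · exact primrecPred_mem_option (by fun_prop) (by fun_prop)
    · exact primrecPred_forall_lt (by fun_prop)
        (primrecPred_mem_option (by fun_prop) (by fun_prop))
  · exact primrecPred_ltCode (by fun_prop) (by fun_prop)
  · exact primrecPred_ltCode (by fun_prop) (by fun_prop)

theorem CellCert.mono {e J l r T T' c : ℕ} (hT : T ≤ T') (h : CellCert e J l r T c) :
    CellCert e J l r T' c := by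
  obtain ⟨h1, h2, h3, h4, ⟨k, hk, hk1, hk2⟩, h5⟩ := h
  exact ⟨h1, h2, h3, h4, ⟨k, hk, Nat.Partrec.Code.evaln_mono hT hk1,
    fun j hj => Nat.Partrec.Code.evaln_mono hT (hk2 j hj)⟩, h5⟩

theorem take_eq_map_range {σ : List ℕ} {ρ : ℕ → ℕ} (h : ∀ i < σ.length, ρ i = σ.getD i 0) {k : ℕ}
    (hk : k ≤ σ.length) : σ.take k = (List.range k).map ρ := by
  refine List.ext_getElem (by simp [hk]) fun i h1 h2 => ?_
  have hi : i < σ.length := by simp at h1; omega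
  simp [h i hi, List.getD_eq_getElem?_getD, hi]

/-- The coded prefix extends to a genuine name of any `x` in the cell. The functional cannot tell
the difference before it answers, so its answer is an entry of a name of `f x` and is close to `f
x`. -/
theorem CellCert.sound {e J l r T c : ℕ} {f : ℝ → ℝ} (hf : IndexesFun e f)
    (h : CellCert e J l r T c) {x : ℝ} (hx : x ∈ Set.Icc (ratOf l : ℝ) (ratOf r)) :
    f x ∈ openInt J := by
  obtain ⟨h1, h2, h3, h4, ⟨k, hk, hk1, hk2⟩, h5, h6⟩ := h
  generalize hσ : Denumerable.ofNat (List ℕ) c.unpair.1.unpair.1 = σ at *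
  generalize c.unpair.1.unpair.2 = n at *
  generalize c.unpair.2 = v at *
  rw [ltCode_iff_real, ratOf_addCode] at h3 h4 h5 h6
  rw [ratOf_negCode] at h3 h5
  rw [ratOf_addCode] at h5 h6
  push_cast [ratOf_halfPowCode, ratOf_hiCode] at h3 h4 h5 h6
  choose τ hτ using fun i : ℕ => exists_ratOf_near x (ε := (2 : ℝ)⁻¹ ^ (i + 2)) (by positivity)
  let ρ : ℕ → ℕ := fun i => if i < σ.length then σ.getD i 0 else τ i
  have hρ : ∀ i < σ.length, ρ i = σ.getD i 0 := fun i hi => if_pos hi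
  have hname : IsRealName ρ x := by
    refine isRealName_of_prefix σ.length (fun i hi => ?_) (fun i hi => ?_) (fun i hi => ?_)
    · rw [hρ i (by omega), hρ (i + 1) hi, ← ratOf_halfPowCode, ← distLtCode_iff]
      exact h2 i (by omega)
    · rw [hρ i (by omega)]
      have : σ.length - 1 = i := by omega
      rw [this] at h3 h4
      exact abs_lt.2 ⟨by linarith [hx.2], by linarith [hx.1]⟩
    · simpa [ρ, not_lt.2 hi] using hτ i
  obtain ⟨s, hs, hsn⟩ := hf x ρ hname
  have hout : FunctionalOutputs e ρ n v := by
    refine ⟨k, ?_, fun j hj => ?_⟩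
    · rw [initSeg, ← take_eq_map_range hρ (by omega)]
      exact Nat.Partrec.Code.evaln_sound hk1
    · rw [initSeg, ← take_eq_map_range hρ (by omega)]
      exact Nat.Partrec.Code.evaln_sound (hk2 j hj)
  have hv := hsn.abs_sub_le n
  rw [← hout.unique (hs n), abs_le] at hv
  have h2n : (2 : ℝ) / 2 ^ n = 2⁻¹ ^ n + 2⁻¹ ^ n := by rw [inv_pow]; ring
  rw [h2n] at hv
  refine ⟨?_, ?_⟩
  · rw [lo]; linarith [hv.2]
  · linarith [hv.1]

/-- Run on a name of `x`, the functional reads only finitely many entries, and that prefix serves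
all points near `x` as well. -/
theorem exists_cellCert {e J : ℕ} {f : ℝ → ℝ} (hf : IndexesFun e f) {x : ℝ}
    (hx : f x ∈ openInt J) : ∃ U : Set ℝ, IsOpen U ∧ x ∈ U ∧ ∃ c T, ∀ l r : ℕ, ratOf l ≤ ratOf r →
      Set.Icc (ratOf l : ℝ) (ratOf r) ⊆ U → CellCert e J l r T c := by
  choose τ hτ using fun i : ℕ => exists_ratOf_near x (ε := (2 : ℝ)⁻¹ ^ (i + 2)) (by positivity)
  have hname : IsRealName τ x :=
    isRealName_of_prefix 0 (by simp) (by simp) fun i _ => hτ i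
  obtain ⟨s, hs, hsn⟩ := hf x τ hname
  -- The output is within `2 * 2⁻¹ ^ n` of `f x`, and the certificate demands the same margin around
  -- the output: four units in all.
  obtain ⟨n, hn⟩ : ∃ n : ℕ, (2 : ℝ)⁻¹ ^ n < min (f x - lo J) (hi J - f x) / 4 :=
    exists_pow_lt_of_lt_one (div_pos (lt_min (sub_pos.2 hx.1) (sub_pos.2 hx.2)) (by norm_num))
      (by norm_num)
  have hn1 := min_le_left (f x - lo J) (hi J - f x)
  have hn2 := min_le_right (f x - lo J) (hi J - f x)
  have hv := abs_le.1 (hsn.abs_sub_le n)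
  have h2n : (2 : ℝ) / 2 ^ n = 2⁻¹ ^ n + 2⁻¹ ^ n := by rw [inv_pow]; ring
  rw [h2n] at hv
  obtain ⟨k, hk, hkj⟩ := hs n
  have hT : ∃ T, s n + 1 ∈ Nat.Partrec.Code.evaln T (Denumerable.ofNat Nat.Partrec.Code e)
      (Nat.pair (initSeg τ k) n) ∧ ∀ j < k, 0 ∈ Nat.Partrec.Code.evaln T
        (Denumerable.ofNat Nat.Partrec.Code e) (Nat.pair (initSeg τ j) n) := by
    obtain ⟨T₀, hT₀⟩ := Nat.Partrec.Code.evaln_complete.1 hk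
    have : ∀ j, ∃ T, j < k → 0 ∈ Nat.Partrec.Code.evaln T
        (Denumerable.ofNat Nat.Partrec.Code e) (Nat.pair (initSeg τ j) n) := by
      intro j
      by_cases hj : j < k
      · obtain ⟨T, hT⟩ := Nat.Partrec.Code.evaln_complete.1 (hkj j hj)
        exact ⟨T, fun _ => hT⟩
      · exact ⟨0, fun h => absurd h hj⟩
    choose T hT using this
    refine ⟨T₀ + ∑ j ∈ Finset.range k, T j, Nat.Partrec.Code.evaln_mono (by omega) hT₀,
      fun j hj => Nat.Partrec.Code.evaln_mono ?_ (hT j hj)⟩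
    exact (Finset.single_le_sum (f := T) (fun _ _ => Nat.zero_le _) (Finset.mem_range.2 hj)).trans
      (by omega)
  obtain ⟨T, hT1, hT2⟩ := hT
  -- One entry more than was read: the prefix is then nonempty even for `k = 0`, and its last entry
  -- is closer to `x` than the certificate requires, which leaves an open neighbourhood.
  let σ : List ℕ := (List.range (k + 1)).map τ
  have hlen : σ.length = k + 1 := by simp [σ]
  have hget : ∀ i < k + 1, σ.getD i 0 = τ i := fun i hi => by
    simp [σ, List.getD_eq_getElem?_getD, hi]
  have htake : ∀ j ≤ k + 1, Encodable.encode (σ.take j) = initSeg τ j := fun j hj => by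
    rw [initSeg, take_eq_map_range (σ := σ) (ρ := τ) (fun i hi => (hget i (hlen ▸ hi)).symm)
      (hj.trans hlen.ge)]
  have hk4 := abs_lt.1 (hτ k)
  have hpow : (2 : ℝ)⁻¹ ^ (k + 2) < 2⁻¹ ^ (k + 1) :=
    pow_lt_pow_right_of_lt_one₀ (by norm_num) (by norm_num) (by omega)
  refine ⟨Set.Ioo (ratOf (τ k) - 2⁻¹ ^ (k + 1)) (ratOf (τ k) + 2⁻¹ ^ (k + 1)), isOpen_Ioo,
    ⟨by linarith, by linarith⟩, Nat.pair (Nat.pair (Encodable.encode σ) n) (s n), T,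
    fun l r hlr hsub => ?_⟩
  have hlr' : (ratOf l : ℝ) ≤ ratOf r := by exact_mod_cast hlr
  simp only [CellCert, Nat.unpair_pair, Denumerable.ofNat_encode, hlen]
  refine ⟨by omega, fun i hi => ?_, ?_, ?_, ⟨k, by omega, ?_, fun j hj => ?_⟩, ?_, ?_⟩
  · rw [distLtCode_iff, ratOf_halfPowCode, hget i (by omega), hget (i + 1) (by omega)]
    exact hname.2 i
  · rw [ltCode_iff_real, ratOf_addCode, ratOf_negCode, hget _ (by omega)]
    push_cast [ratOf_halfPowCode]
    exact (hsub (Set.left_mem_Icc.2 hlr')).1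
  · rw [ltCode_iff_real, ratOf_addCode, hget _ (by omega)]
    push_cast [ratOf_halfPowCode]
    exact (hsub (Set.right_mem_Icc.2 hlr')).2
  · rw [htake k (by omega)]; exact hT1
  · rw [htake j (by omega)]; exact hT2 j hj
  · rw [ltCode_iff_real, ratOf_addCode, ratOf_negCode, ratOf_addCode]
    push_cast [ratOf_halfPowCode]
    change (lo J : ℝ) < _
    linarith [hv.1]
  · rw [ltCode_iff_real, ratOf_addCode, ratOf_addCode]
    push_cast [ratOf_halfPowCode, ratOf_hiCode]
    linarith [hv.2]

/-- `c` codes a pair of intervals `I` and `J`, and `t` codes a certificate that the function with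
index `e` maps `I` into `J`. -/
def MapsCert (e c t : ℕ) : Prop :=
  ∀ j < t.unpair.1 + 1, ∃ w < t.unpair.2, CellCert e c.unpair.2
    (interpCode c.unpair.1.unpair.1 (hiCode c.unpair.1) j t.unpair.1)
    (interpCode c.unpair.1.unpair.1 (hiCode c.unpair.1) (j + 1) t.unpair.1) t.unpair.2 w

theorem primrecPred_mapsCert : PrimrecPred fun a : ℕ × ℕ × ℕ => MapsCert a.1 a.2.1 a.2.2 := by
  unfold MapsCert
  exact primrecPred_forall_lt (by fun_prop) (primrecPred_exists_lt (by fun_prop)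
    (primrecPred_cellCert (by fun_prop) (by fun_prop) (by fun_prop) (by fun_prop) (by fun_prop)
      (by fun_prop)))

theorem exists_mapsCert_iff {e : ℕ} {f : ℝ → ℝ} (hf : IndexesFun e f) (c : ℕ) :
    (∃ t, MapsCert e c t) ↔ f '' compactInt c.unpair.1 ⊆ openInt c.unpair.2 := by
  have hcast : ∀ j t : ℕ, j ≤ t + 1 →
      (ratOf (interpCode c.unpair.1.unpair.1 (hiCode c.unpair.1) j t) : ℝ) =
        ((t + 1 - j) * (lo c.unpair.1 : ℝ) + j * hi c.unpair.1) / (t + 1) := by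
    intro j t hj
    rw [ratOf_interpCode _ _ _ _ hj, ratOf_hiCode, lo]
    push_cast
    rfl
  constructor
  · rintro ⟨t, ht⟩ _ ⟨x, hx, rfl⟩
    obtain ⟨j, hj, hxj⟩ := exists_mem_subdivision t.unpair.1 hx
    obtain ⟨w, -, hw⟩ := ht j hj
    refine hw.sound hf ?_
    rwa [hcast j _ hj.le, hcast (j + 1) _ hj]
  · intro h
    have hx : ∀ x : compactInt c.unpair.1, f x ∈ openInt c.unpair.2 :=
      fun x => h ⟨x, x.2, rfl⟩
    choose U hU hxU w T hw using fun x => exists_cellCert hf (hx x)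
    have hle : (lo c.unpair.1 : ℝ) ≤ hi c.unpair.1 := by exact_mod_cast (lo_lt_hi _).le
    obtain ⟨t, ht⟩ := exists_subdivision hU hle
      (fun x hx => Set.mem_iUnion.2 ⟨⟨x, hx⟩, hxU ⟨x, hx⟩⟩)
    replace ht := ht t le_rfl
    have : Nonempty (compactInt c.unpair.1) := ⟨⟨_, Set.left_mem_Icc.2 hle⟩⟩
    choose! i hi' using fun j (hj : j < t + 1) => ht j hj
    have hS : ∀ j < t + 1, w (i j) + 1 ≤ ∑ j ∈ Finset.range (t + 1), (w (i j) + 1 + T (i j)) ∧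
        T (i j) ≤ ∑ j ∈ Finset.range (t + 1), (w (i j) + 1 + T (i j)) := by
      intro j hj
      have := Finset.single_le_sum (f := fun j => w (i j) + 1 + T (i j))
        (fun _ _ => Nat.zero_le _) (Finset.mem_range.2 hj)
      omega
    -- A single number serves as search bound for the certificates of all cells and as running time
    -- for all of them.
    refine ⟨Nat.pair t (∑ j ∈ Finset.range (t + 1), (w (i j) + 1 + T (i j))), fun j hj => ?_⟩
    simp only [Nat.unpair_pair] at hj ⊢
    refine ⟨w (i j), (hS j hj).1, (hw (i j) _ _ ?_ ?_).mono (hS j hj).2⟩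
    · rw [← Rat.cast_le (K := ℝ), hcast j _ hj.le, hcast (j + 1) _ hj]
      push_cast
      gcongr ?_ / _
      nlinarith
    · rw [hcast j _ hj.le, hcast (j + 1) _ hj]
      exact hi' j hj

theorem exists_image_subset {f : ℝ → ℝ} (hf : Continuous f) (i : ℕ) :
    ∃ J, f '' compactInt i ⊆ openInt J := by
  obtain ⟨R, hR⟩ := ((isCompact_Icc (a := (lo i : ℝ)) (b := hi i)).image hf).isBounded.subset_ball 0
  obtain ⟨n, hn⟩ := exists_nat_gt R
  obtain ⟨J, h1, h2⟩ := exists_lo_hi_eq (show (-(n + 1 : ℕ) : ℚ) < (n + 1 : ℕ) by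
    have : (0 : ℚ) < (n + 1 : ℕ) := by positivity
    linarith)
  refine ⟨J, hR.trans fun y hy => ?_⟩
  rw [Metric.mem_ball, Real.dist_eq, sub_zero, abs_lt] at hy
  rw [openInt, h1, h2]
  push_cast
  exact ⟨by linarith [hy.1], by linarith [hy.2]⟩

theorem exists_funName_index :
    ∃ h : ℕ → ℕ, Primrec h ∧ ∀ e f, Continuous f → IndexesFun e f →
      ∃ ρ, Indexes (h e) ρ ∧ IsFunName ρ f := by
  obtain ⟨h, hh, H⟩ := exists_enumeration primrecPred_mapsCert
  refine ⟨h, hh, fun e f hf he => ?_⟩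
  -- An enumeration needs at least one element; boundedness of `f` on one interval provides it.
  obtain ⟨J, hJ⟩ := exists_image_subset hf 0
  obtain ⟨t, ht⟩ := (exists_mapsCert_iff he (Nat.pair 0 J)).2 (by simpa using hJ)
  obtain ⟨ρ, h1, h2⟩ := H e ⟨_, t, ht⟩
  refine ⟨ρ, h1, h2.trans ?_⟩
  ext c
  exact exists_mapsCert_iff he c

/-! ### Running a Turing functional on computable oracles -/

/-- The initial segments of the join of the partial functions `phi a` and `phi b`. -/
def joinSeg (a b k : ℕ) : Part (List ℕ) :=
  Nat.rec (Part.some []) (fun j S => S.bind fun l =>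
    (phi a j).bind fun x => (phi b j).map fun y => l ++ [Nat.pair x y]) k

theorem joinSeg_eq {a b : ℕ} {ρ κ : ℕ → ℕ} (ha : Indexes a ρ) (hb : Indexes b κ) (k : ℕ) :
    joinSeg a b k = Part.some ((List.range k).map (join ρ κ)) := by
  induction k with
  | zero => rfl
  | succ k ih =>
    have h : joinSeg a b (k + 1) = (joinSeg a b k).bind fun l =>
      (phi a k).bind fun x => (phi b k).map fun y => l ++ [Nat.pair x y] := rfl
    rw [h, ih, Part.eq_some_iff.2 (ha k), Part.eq_some_iff.2 (hb k)]
    simp [List.range_succ, join]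

theorem partrec_joinSeg : Partrec fun a : (ℕ × ℕ) × ℕ => joinSeg a.1.1 a.1.2 a.2 := by
  have h : Partrec₂ fun (a : (ℕ × ℕ) × ℕ) (q : ℕ × List ℕ) =>
      (phi a.1.1 q.1).bind fun x => (phi a.1.2 q.1).map fun y => q.2 ++ [Nat.pair x y] := by
    refine Partrec.bind (partrec₂_phi.comp ?_ ?_) (Partrec.map (partrec₂_phi.comp ?_ ?_) ?_)
    · exact (Primrec.to_comp (by fun_prop))
    · exact (Primrec.to_comp (by fun_prop))
    · exact (Primrec.to_comp (by fun_prop))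
    · exact (Primrec.to_comp (by fun_prop))
    · exact (Primrec.list_concat.comp (by fun_prop) (by fun_prop)).to_comp
  exact Partrec.nat_rec (f := fun a : (ℕ × ℕ) × ℕ => a.2) (g := fun _ => Part.some [])
    Computable.snd (Computable.const _).partrec h

/-- Oracle queries are answered by computing `phi a` and `phi b`, and segments are lengthened until
the answer is positive. -/
theorem exists_run_index (E : ℕ) :
    ∃ h : ℕ → ℕ, Primrec h ∧ ∀ a b ρ κ g, Indexes a ρ → Indexes b κ →
      FunctionalComputes E (join ρ κ) g → Indexes (h (Nat.pair a b)) g := by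
  let val : ℕ × ℕ → ℕ → Part ℕ := fun q k =>
    (joinSeg q.1.unpair.1 q.1.unpair.2 k).bind fun l => phi E (Nat.pair (Encodable.encode l) q.2)
  have hval : Partrec₂ val := by
    refine Partrec.bind (partrec_joinSeg.comp
      (g := fun a : (ℕ × ℕ) × ℕ => ((a.1.1.unpair.1, a.1.1.unpair.2), a.2))
      (Primrec.to_comp (by fun_prop))) (partrec₂_phi.comp (Computable.const _)
      (Primrec.to_comp (by fun_prop)))
  have hrun : Partrec fun q : ℕ × ℕ =>
      (Nat.rfind fun k => (val q k).map fun r => decide (0 < r)).bind fun k =>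
        (val q k).map Nat.pred := by
    refine Partrec.bind (Partrec.rfind (Partrec.map hval ?_)) (Partrec.map hval ?_)
    · exact (primrecPred_lt (Primrec.const 0) Primrec.snd).decide.to_comp
    · exact (Primrec.pred.comp Primrec.snd).to_comp
  obtain ⟨h, hh, hphi⟩ := exists_index_param hrun.to₂
  refine ⟨h, hh, fun a b ρ κ g ha hb hg n => ?_⟩
  have hv : ∀ k, val (Nat.pair a b, n) k = phi E (Nat.pair (initSeg (join ρ κ) k) n) := by
    intro k
    simp [val, joinSeg_eq ha hb, initSeg]
  obtain ⟨k, hk, hkj⟩ := hg n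
  rw [hphi, Part.mem_bind_iff]
  refine ⟨k, Nat.mem_rfind.2 ⟨?_, fun {j} hj => ?_⟩, ?_⟩
  · rw [hv, Part.mem_map_iff]
    exact ⟨_, hk, by simp⟩
  · rw [hv, Part.mem_map_iff]
    exact ⟨_, hkj j hj, by simp⟩
  · rw [hv, Part.mem_map_iff]
    exact ⟨_, hk, rfl⟩

theorem UniformEffectiveVagueTendsto.effectiveVagueTendsto {μ : ℕ → Measure ℝ} {ν : Measure ℝ}
    (h : UniformEffectiveVagueTendsto μ ν) : EffectiveVagueTendsto μ ν := by
  obtain ⟨hv, E, hE⟩ := h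
  refine ⟨fun f hf hs _ => hv f hf hs, ?_⟩
  obtain ⟨hn, hn1, hn2⟩ := exists_funName_index
  obtain ⟨hr, hr1, hr2⟩ := exists_run_index E
  have hP : Primrec fun p : ℕ => hr (Nat.pair (hn p.unpair.1) p.unpair.2) := by fun_prop
  refine ⟨fun p => Part.some (hr (Nat.pair (hn p.unpair.1) p.unpair.2)),
    Partrec.nat_iff.1 hP.to_comp.partrec, fun f e k hf hs he ⟨κ, hk, hκ⟩ => ?_⟩
  obtain ⟨ρ, hρ, hρf⟩ := hn2 e f hf he
  obtain ⟨g, hg, hmod⟩ := hE f hf hs ρ κ hρf hκ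
  refine ⟨_, Part.mem_some _, g, ?_, hmod⟩
  simpa using hr2 _ _ ρ κ g hρ hk hg

/-! ### Tent functions -/

/-- The tent function with apex `(a - b) / (N + 1)` and slope `N + 1`. -/
def tent (N a b : ℕ) (x : ℝ) : ℝ := max 0 (1 - |((N : ℝ) + 1) * x + b - a|)

theorem continuous_tent (N a b : ℕ) : Continuous (tent N a b) := by unfold tent; fun_prop

theorem tent_nonneg (N a b : ℕ) (x : ℝ) : 0 ≤ tent N a b x := le_max_left _ _

theorem tent_le_one (N a b : ℕ) (x : ℝ) : tent N a b x ≤ 1 :=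
  max_le zero_le_one (by linarith [abs_nonneg (((N : ℝ) + 1) * x + b - a)])

theorem abs_tent_sub_le (N a b : ℕ) (x y : ℝ) :
    |tent N a b x - tent N a b y| ≤ (N + 1) * |x - y| := by
  have h1 := abs_max_sub_max_le_abs (1 - |((N : ℝ) + 1) * x + b - a|)
    (1 - |((N : ℝ) + 1) * y + b - a|) 0
  have h2 := abs_abs_sub_abs_le_abs_sub (((N : ℝ) + 1) * y + b - a) (((N : ℝ) + 1) * x + b - a)
  have h3 : |((N : ℝ) + 1) * y + b - a - (((N : ℝ) + 1) * x + b - a)| = (N + 1) * |x - y| := by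
    rw [show ((N : ℝ) + 1) * y + b - a - (((N : ℝ) + 1) * x + b - a) = (N + 1) * (y - x) by ring,
      abs_mul, abs_of_pos (by positivity : (0 : ℝ) < N + 1), abs_sub_comm]
  rw [tent, tent, max_comm, max_comm 0]
  refine h1.trans ?_
  rw [← h3]
  convert h2 using 2
  ring

theorem tent_pos_iff (N a b : ℕ) (x : ℝ) :
    0 < tent N a b x ↔ x ∈ Set.Ioo (((a : ℝ) - (b + 1)) / (N + 1)) ((a + 1 - b) / (N + 1)) := by
  have hN : (0 : ℝ) < N + 1 := by positivity
  rw [tent, lt_max_iff, or_iff_right (lt_irrefl _), sub_pos, abs_lt, Set.mem_Ioo, div_lt_iff₀ hN,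
    lt_div_iff₀ hN]
  constructor <;> rintro ⟨h1, h2⟩ <;> constructor <;> linarith

theorem tsupport_tent (N a b : ℕ) : tsupport (tent N a b) =
    Set.Icc (((a : ℝ) - (b + 1)) / (N + 1)) ((a + 1 - b) / (N + 1)) := by
  have hN : (0 : ℝ) < N + 1 := by positivity
  have h : Function.support (tent N a b) =
      Set.Ioo (((a : ℝ) - (b + 1)) / (N + 1)) ((a + 1 - b) / (N + 1)) := by
    ext x
    rw [← tent_pos_iff, Function.mem_support]
    exact ⟨fun h => (tent_nonneg N a b x).lt_of_ne' h, fun h => h.ne'⟩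
  rw [tsupport, h, closure_Ioo]
  exact (div_lt_div_of_pos_right (by linarith) hN).ne

theorem hasCompactSupport_tent (N a b : ℕ) : HasCompactSupport (tent N a b) := by
  rw [HasCompactSupport, tsupport_tent]
  exact isCompact_Icc

/-! ### Indices of tent functions -/

/-- The value of the tent function at the rational with code `c`. -/
def tentCode (N a b c : ℕ) : ℕ :=
  ratCode (c.unpair.2 + 1 -
    (((N + 1) * c.unpair.1.unpair.1 + b * (c.unpair.2 + 1) -
        ((N + 1) * c.unpair.1.unpair.2 + a * (c.unpair.2 + 1))) +
      ((N + 1) * c.unpair.1.unpair.2 + a * (c.unpair.2 + 1) -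
        ((N + 1) * c.unpair.1.unpair.1 + b * (c.unpair.2 + 1))))) 0 c.unpair.2

theorem cast_sub_add_sub_eq_abs (x y : ℕ) : ((x - y + (y - x) : ℕ) : ℝ) = |(x : ℝ) - y| := by
  rcases le_total x y with h | h
  · rw [Nat.sub_eq_zero_of_le h, zero_add, Nat.cast_sub h, abs_sub_comm, abs_of_nonneg]
    exact sub_nonneg.2 (by exact_mod_cast h)
  · rw [Nat.sub_eq_zero_of_le h, add_zero, Nat.cast_sub h, abs_of_nonneg]
    exact sub_nonneg.2 (by exact_mod_cast h)

theorem cast_sub_eq_max (x y : ℕ) : ((x - y : ℕ) : ℝ) = max 0 ((x : ℝ) - y) := by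
  rcases le_total x y with h | h
  · rw [Nat.sub_eq_zero_of_le h, max_eq_left, Nat.cast_zero]
    exact sub_nonpos.2 (by exact_mod_cast h)
  · rw [Nat.cast_sub h, max_eq_right]
    exact sub_nonneg.2 (by exact_mod_cast h)

theorem ratOf_ratCode_sub_abs (X Y d : ℕ) :
    (ratOf (ratCode (d + 1 - (X - Y + (Y - X))) 0 d) : ℝ) = max 0 (1 - |((X : ℝ) - Y) / (d + 1)|) := by
  have hd : (0 : ℝ) < (d : ℝ) + 1 := by positivity
  have h : (ratOf (ratCode (d + 1 - (X - Y + (Y - X))) 0 d) : ℝ) =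
      ((d + 1 - (X - Y + (Y - X)) : ℕ) : ℝ) / (d + 1) := by
    simp [ratOf_ratCode]
  rw [h, cast_sub_eq_max, cast_sub_add_sub_eq_abs, abs_div, abs_of_pos hd, ← max_div_div_right hd.le,
    zero_div, sub_div, Nat.cast_add_one, div_self hd.ne']

theorem ratOf_tentCode (N a b c : ℕ) :
    (ratOf (tentCode N a b c) : ℝ) = tent N a b (ratOf c) := by
  have hd : (0 : ℝ) < (c.unpair.2 : ℝ) + 1 := by positivity
  rw [tentCode, ratOf_ratCode_sub_abs, tent, ratOf]
  push_cast
  congr 3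
  field_simp
  ring

theorem exists_tent_index : ∃ h : ℕ → ℕ, Primrec h ∧ ∀ p,
    IndexesFun (h p) (tent p.unpair.1 p.unpair.2.unpair.1 p.unpair.2.unpair.2) := by
  -- The Lipschitz constant `N + 1` is at most `2 ^ N`, so reading the name `N` entries further
  -- compensates for it.
  let F : ℕ → List ℕ → ℕ → ℕ := fun p L n => if n + p.unpair.1 < L.length then
    tentCode p.unpair.1 p.unpair.2.unpair.1 p.unpair.2.unpair.2 (L.getD (n + p.unpair.1) 0) + 1
    else 0
  have hF : Primrec fun a : ℕ × List ℕ × ℕ => F a.1 a.2.1 a.2.2 := by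
    refine Primrec.ite (primrecPred_lt (by fun_prop) (by fun_prop)) ?_ (Primrec.const 0)
    unfold tentCode
    fun_prop
  obtain ⟨h, hh, H⟩ := exists_functional_param hF.to_comp
  refine ⟨h, hh, fun p x ρ hρ => ?_⟩
  set N := p.unpair.1 with hN
  set a := p.unpair.2.unpair.1 with ha
  set b := p.unpair.2.unpair.2 with hb
  refine ⟨fun n => tentCode N a b (ρ (n + N)), fun n => ?_, ?_, fun n => ?_⟩
  · refine H p ρ n _ (n + N + 1) ?_ fun j hj => ?_
    · simp [F, List.getD_eq_getElem?_getD, ← hN, ← ha, ← hb]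
    · have : ¬ n + N < j := by omega
      simp [F, ← hN, this]
  · simp only [ratOf_tentCode]
    exact ((continuous_tent N a b).tendsto x).comp (hρ.1.comp (tendsto_add_atTop_nat N))
  · simp only [ratOf_tentCode]
    refine (abs_tent_sub_le N a b _ _).trans_lt ?_
    have h1 := hρ.2 (n + N)
    rw [add_right_comm] at h1
    have h2 : (N : ℝ) + 1 ≤ 2 ^ N := by exact_mod_cast Nat.lt_two_pow_self (n := N)
    have h3 : ((N : ℝ) + 1) * 2⁻¹ ^ (n + N) ≤ 2⁻¹ ^ n := by
      rw [inv_pow, inv_pow, pow_add, mul_inv, mul_comm, mul_assoc]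
      refine mul_le_of_le_one_right (by positivity) ?_
      rw [inv_mul_le_iff₀ (by positivity)]
      linarith
    exact (mul_lt_mul_of_pos_left h1 (by positivity)).trans_le h3

/-! ### Indices of compact rational intervals -/

theorem openInt_inter_Icc_nonempty {i : ℕ} {x y : ℝ} (hxy : x < y) :
    (openInt i ∩ Set.Icc x y).Nonempty ↔ (lo i : ℝ) < y ∧ x < hi i := by
  constructor
  · rintro ⟨z, hz1, hz2⟩
    exact ⟨hz1.1.trans_le hz2.2, hz2.1.trans_lt hz1.2⟩
  · rintro ⟨h1, h2⟩
    have h3 : (lo i : ℝ) < hi i := by exact_mod_cast lo_lt_hi i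
    obtain ⟨z, hz1, hz2⟩ := exists_between (max_lt (lt_min h3 h1) (lt_min h2 hxy))
    rw [max_lt_iff] at hz1
    rw [lt_min_iff] at hz2
    exact ⟨z, ⟨hz1.1, hz2.1⟩, hz1.2.le, hz2.2.le⟩

/-- `c` codes a minimal cover of the compact interval whose endpoints have codes `x` and `y`, as
witnessed by a division into `t + 1` equal parts. -/
def CoverCert (x y c t : ℕ) : Prop :=
  (∀ i ∈ Denumerable.ofNat (List ℕ) c, LtCode i.unpair.1 y ∧ LtCode x (hiCode i)) ∧
  ∀ j < t + 1, ∃ i ∈ Denumerable.ofNat (List ℕ) c,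
    LtCode i.unpair.1 (interpCode x y j t) ∧ LtCode (interpCode x y (j + 1) t) (hiCode i)

theorem primrecPred_coverCert {α : Type*} [Primcodable α] {x y c t : α → ℕ}
    (hx : Primrec x) (hy : Primrec y) (hc : Primrec c) (ht : Primrec t) :
    PrimrecPred fun a => CoverCert (x a) (y a) (c a) (t a) := by
  unfold CoverCert
  refine .and (primrecPred_forall_mem (by fun_prop) (.and ?_ ?_)) (primrecPred_forall_lt
    (by fun_prop) (primrecPred_exists_mem (by fun_prop) (.and ?_ ?_))) <;>
  exact primrecPred_ltCode (by fun_prop) (by fun_prop)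

/-- Meeting the interval is decidable from the endpoints; covering it is witnessed, by the Lebesgue
number lemma, by a subdivision each of whose cells lies inside one member. -/
theorem exists_coverCert_iff {x y : ℕ} (hxy : (ratOf x : ℝ) < ratOf y) (c : ℕ) :
    (∃ t, CoverCert x y c t) ↔
      IsMinCover (Denumerable.ofNat (List ℕ) c) (Set.Icc (ratOf x : ℝ) (ratOf y)) := by
  have hcast : ∀ j t : ℕ, j ≤ t + 1 → (ratOf (interpCode x y j t) : ℝ) =
      ((t + 1 - j) * (ratOf x : ℝ) + j * ratOf y) / (t + 1) := by
    intro j t hj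
    rw [ratOf_interpCode _ _ _ _ hj]
    push_cast
    rfl
  have hmeet : ∀ i, LtCode i.unpair.1 y ∧ LtCode x (hiCode i) ↔
      (openInt i ∩ Set.Icc (ratOf x : ℝ) (ratOf y)).Nonempty := fun i => by
    rw [openInt_inter_Icc_nonempty hxy, ltCode_iff_real, ltCode_iff_real, ratOf_hiCode, lo]
  constructor
  · rintro ⟨t, h1, h2⟩
    refine ⟨fun z hz => ?_, fun i hi => (hmeet i).1 (h1 i hi)⟩
    obtain ⟨j, hj, hzj⟩ := exists_mem_subdivision t hz
    obtain ⟨i, hi, hij⟩ := h2 j hj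
    rw [ltCode_iff_real, ltCode_iff_real, ratOf_hiCode, hcast j t hj.le, hcast (j + 1) t hj] at hij
    exact Set.mem_iUnion₂.2 ⟨i, hi, hij.1.trans_le hzj.1, hzj.2.trans_lt hij.2⟩
  · rintro ⟨h1, h2⟩
    obtain ⟨t, ht⟩ := exists_subdivision (ι := {i // i ∈ Denumerable.ofNat (List ℕ) c})
      (U := fun i => openInt i) (fun i => isOpen_Ioo) hxy.le (fun z hz => by
        obtain ⟨i, hi, hzi⟩ := Set.mem_iUnion₂.1 (h1 hz)
        exact Set.mem_iUnion.2 ⟨⟨i, hi⟩, hzi⟩)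
    refine ⟨t, fun i hi => (hmeet i).2 (h2 i hi), fun j hj => ?_⟩
    obtain ⟨⟨i, hi⟩, hij⟩ := ht t le_rfl j hj
    refine ⟨i, hi, ?_⟩
    have hle : ((t + 1 - j) * (ratOf x : ℝ) + j * ratOf y) / (t + 1) ≤
        ((t + 1 - (j + 1 : ℕ)) * (ratOf x : ℝ) + (j + 1 : ℕ) * ratOf y) / (t + 1) := by
      push_cast
      gcongr ?_ / _
      linarith
    rw [ltCode_iff_real, ltCode_iff_real, ratOf_hiCode, hcast j t hj.le, hcast (j + 1) t hj]
    exact ⟨(hij (Set.left_mem_Icc.2 hle)).1, (hij (Set.right_mem_Icc.2 hle)).2⟩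

theorem exists_tent_support_index : ∃ h : ℕ → ℕ, Primrec h ∧ ∀ p, IndexesCompact (h p)
    (tsupport (tent p.unpair.1 p.unpair.2.unpair.1 p.unpair.2.unpair.2)) := by
  let x : ℕ → ℕ := fun p => ratCode p.unpair.2.unpair.1 (p.unpair.2.unpair.2 + 1) p.unpair.1
  let y : ℕ → ℕ := fun p => ratCode (p.unpair.2.unpair.1 + 1) p.unpair.2.unpair.2 p.unpair.1
  have hR : PrimrecPred fun a : ℕ × ℕ × ℕ => CoverCert (x a.1) (y a.1) a.2.1 a.2.2 :=
    primrecPred_coverCert (by simp only [x]; fun_prop) (by simp only [y]; fun_prop) (by fun_prop)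
      (by fun_prop)
  obtain ⟨h, hh, H⟩ := exists_enumeration (R := fun p c t => CoverCert (x p) (y p) c t) hR
  refine ⟨h, hh, fun p => ?_⟩
  have hN : (0 : ℝ) < p.unpair.1 + 1 := by positivity
  have hx : (ratOf (x p) : ℝ) =
      ((p.unpair.2.unpair.1 : ℝ) - (p.unpair.2.unpair.2 + 1)) / (p.unpair.1 + 1) := by
    simp only [x, ratOf_ratCode]
    push_cast
    rfl
  have hy : (ratOf (y p) : ℝ) =
      ((p.unpair.2.unpair.1 : ℝ) + 1 - p.unpair.2.unpair.2) / (p.unpair.1 + 1) := by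
    simp only [y, ratOf_ratCode]
    push_cast
    rfl
  have hxy : (ratOf (x p) : ℝ) < ratOf (y p) := by
    rw [hx, hy]
    exact div_lt_div_of_pos_right (by linarith) hN
  have hxy' : ratOf (x p) < ratOf (y p) := by exact_mod_cast hxy
  obtain ⟨i, hi1, hi2⟩ := exists_lo_hi_eq (x := ratOf (x p) - 1) (y := ratOf (y p) + 1)
    (by linarith)
  have hcov : IsMinCover (Denumerable.ofNat (List ℕ) (Encodable.encode [i]))
      (Set.Icc (ratOf (x p) : ℝ) (ratOf (y p))) := by
    rw [Denumerable.ofNat_encode]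
    refine ⟨fun z hz => ?_, fun j hj => ?_⟩
    · simp only [List.mem_singleton, Set.iUnion_iUnion_eq_left, openInt, hi1, hi2]
      push_cast
      exact ⟨by linarith [hz.1], by linarith [hz.2]⟩
    · obtain rfl := List.mem_singleton.1 hj
      rw [openInt_inter_Icc_nonempty hxy, hi1, hi2]
      push_cast
      exact ⟨by linarith, by linarith⟩
  obtain ⟨t, ht⟩ := (exists_coverCert_iff hxy _).2 hcov
  obtain ⟨κ, h1, h2⟩ := H p ⟨_, t, ht⟩
  refine ⟨κ, h1, h2.trans ?_⟩
  ext c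
  rw [tsupport_tent, ← hx, ← hy]
  exact exists_coverCert_iff hxy c

/-! ### Computable data extracted from the hypotheses -/

/-- The only use of the effective hypothesis. The selected moduli depend computably on the
parameters because they are values of one partial computable function, defined everywhere. -/
theorem EffectiveVagueTendsto.exists_tent_modulus {μ : ℕ → Measure ℝ} {ν : Measure ℝ}
    (h : EffectiveVagueTendsto μ ν) : ∃ m : ℕ → ℕ → ℕ, Computable₂ m ∧ ∀ p,
      IsModulus (m p)
        (fun n => ∫ x, tent p.unpair.1 p.unpair.2.unpair.1 p.unpair.2.unpair.2 x ∂(μ n))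
        (∫ x, tent p.unpair.1 p.unpair.2.unpair.1 p.unpair.2.unpair.2 x ∂ν) := by
  obtain ⟨-, P, hP, H⟩ := h
  obtain ⟨e, he, he'⟩ := exists_tent_index
  obtain ⟨s, hs, hs'⟩ := exists_tent_support_index
  have hpart : Partrec fun q : ℕ × ℕ =>
      (P (Nat.pair (e q.1) (s q.1))).bind fun m => phi m q.2 := by
    have h1 : Primrec fun q : ℕ × ℕ => Nat.pair (e q.1) (s q.1) := by fun_prop
    have h2 : Primrec fun q : (ℕ × ℕ) × ℕ => q.1.2 := by fun_prop
    exact ((Partrec.nat_iff.2 hP).comp h1.to_comp).bind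
      (partrec₂_phi.comp Computable.snd h2.to_comp)
  choose m hm g hg hmod using fun p => H _ _ _ (continuous_tent _ _ _)
    (hasCompactSupport_tent _ _ _) (he' p) (hs' p)
  refine ⟨g, ?_, hmod⟩
  exact hpart.of_eq_tot fun q => Part.mem_bind_iff.2 ⟨m q.1, hm q.1, hg q.1 q.2⟩

theorem UniformlyComputable.exists_bound {μ : ℕ → Measure ℝ} (h : UniformlyComputable μ) :
    ∃ b : ℕ → ℕ, Computable b ∧ ∀ n, (μ n).real Set.univ ≤ b n := by
  obtain ⟨⟨P, hP, H⟩, -⟩ := h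
  choose a ha ρ hρ hname using H
  have hpart : Partrec fun n : ℕ => (P n).bind fun m => phi m 0 :=
    (Partrec.nat_iff.2 hP).bind (partrec₂_phi.comp Computable.snd (Computable.const 0))
  have hc : Computable fun n => ρ n 0 :=
    hpart.of_eq_tot fun n => Part.mem_bind_iff.2 ⟨a n, ha n, hρ n 0⟩
  have hadd : Primrec fun m : ℕ => m + 2 := by fun_prop
  -- Entry `0` of a name is within `2` of the real, and its code bounds its size.
  refine ⟨fun n => ρ n 0 + 2, hadd.to_comp.comp hc, fun n => ?_⟩
  have h1 := abs_le.1 ((hname n).abs_sub_le 0)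
  have h2 := (le_abs_self _).trans (abs_ratOf_le (ρ n 0))
  push_cast
  linarith [h1.1]

/-! ### Approximation by sums of tent functions -/

/-- Unit hats at `0, …, K` add up to a trapezoid equal to `1` on `[0, K]`; each further hat moves
its right flank by one. -/
theorem sum_max_zero_one_sub_abs (K : ℕ) (y : ℝ) :
    ∑ i ∈ Finset.range (K + 1), max 0 (1 - |y - i|) =
      max 0 (min 1 (min (1 + y) (K + 1 - y))) := by
  induction K with
  | zero =>
    simp only [zero_add, Finset.range_one, Finset.sum_singleton, Nat.cast_zero, sub_zero]
    grind
  | succ K ih =>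
    rw [Finset.sum_range_succ, ih]
    have : (0 : ℝ) ≤ K := by positivity
    push_cast
    grind

theorem sum_tent (N b K : ℕ) (x : ℝ) :
    ∑ i ∈ Finset.range (K + 1), tent N i b x =
      max 0 (min 1 (min (1 + ((N + 1) * x + b)) (K + 1 - ((N + 1) * x + b)))) := by
  rw [← sum_max_zero_one_sub_abs]
  rfl

theorem sum_tent_eq_one {N M : ℕ} {x : ℝ} (hx : |x| ≤ M) :
    ∑ i ∈ Finset.range (2 * (M * (N + 1)) + 1), tent N i (M * (N + 1)) x = 1 := by
  have h := abs_le.1 hx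
  have hN : (0 : ℝ) < N + 1 := by positivity
  rw [sum_tent]
  push_cast
  rw [min_eq_left, max_eq_right zero_le_one]
  exact le_min (by nlinarith) (by nlinarith)

/-- The fine sum is at most `1` and vanishes off `[-(M + 1), M + 1]`, where the unit tents sum to
`1`. The right side does not involve `N`, so mass bounds can be found before `N`. -/
theorem sum_tent_le (N M : ℕ) (x : ℝ) :
    ∑ i ∈ Finset.range (2 * (M * (N + 1)) + 1), tent N i (M * (N + 1)) x ≤
      ∑ i ∈ Finset.range (2 * (M + 1) + 1), tent 0 i (M + 1) x := by
  by_cases hx : |x| ≤ (M + 1 : ℕ)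
  · have h1 := sum_tent_eq_one (N := 0) hx
    simp only [zero_add, mul_one] at h1
    rw [h1, sum_tent]
    exact max_le zero_le_one (min_le_left _ _)
  · refine le_trans (le_of_eq ?_) (Finset.sum_nonneg fun i _ => tent_nonneg _ _ _ _)
    refine Finset.sum_eq_zero fun i hi => ?_
    have hi' : (i : ℝ) ≤ 2 * (M * (N + 1)) := by
      exact_mod_cast Nat.lt_succ_iff.1 (Finset.mem_range.1 hi)
    have hi0 : (0 : ℝ) ≤ i := by positivity
    have hN : (0 : ℝ) < N + 1 := by positivity
    have hN0 : (0 : ℝ) ≤ N := by positivity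
    push_cast at hx
    refine le_antisymm (not_lt.1 fun h => hx ?_) (tent_nonneg _ _ _ _)
    rw [tent_pos_iff, Set.mem_Ioo, div_lt_iff₀ hN, lt_div_iff₀ hN] at h
    push_cast at h
    refine abs_le.2 ⟨?_, ?_⟩
    · by_contra! hc
      nlinarith [h.1, h.2]
    · by_contra! hc
      nlinarith [h.1, h.2]

theorem integrable_tent (m : Measure ℝ) [IsLocallyFiniteMeasure m] (N a b : ℕ) :
    Integrable (tent N a b) m :=
  (continuous_tent N a b).integrable_of_hasCompactSupport (hasCompactSupport_tent N a b)

/-- Multiplying `f` by the partition of unity turns the difference into the sum of the `(f - c i)`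
times tents, at most `ε` times the sum of the tents pointwise. -/
theorem abs_integral_sub_sum_le (m : Measure ℝ) [IsLocallyFiniteMeasure m] {f : ℝ → ℝ}
    (hf : Continuous f) (hs : HasCompactSupport f) {M N : ℕ} (hM : ∀ x, f x ≠ 0 → |x| ≤ M)
    {ε B : ℝ} (hε : 0 ≤ ε) {c : ℕ → ℝ}
    (hc : ∀ i < 2 * (M * (N + 1)) + 1, ∀ x, 0 < tent N i (M * (N + 1)) x → |f x - c i| ≤ ε)
    (hB : ∑ i ∈ Finset.range (2 * (M + 1) + 1), ∫ x, tent 0 i (M + 1) x ∂m ≤ B) :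
    |∫ x, f x ∂m - ∑ i ∈ Finset.range (2 * (M * (N + 1)) + 1),
      c i * ∫ x, tent N i (M * (N + 1)) x ∂m| ≤ ε * B := by
  have hfi : Integrable f m := hf.integrable_of_hasCompactSupport hs
  have hti : ∀ i ∈ Finset.range (2 * (M * (N + 1)) + 1),
      Integrable (fun x => c i * tent N i (M * (N + 1)) x) m :=
    fun i _ => (integrable_tent m _ _ _).const_mul _
  simp only [← integral_const_mul]
  rw [← integral_finsetSum _ hti, ← integral_sub hfi (integrable_finsetSum _ hti)]
  have hpt : ∀ x, ‖f x - ∑ i ∈ Finset.range (2 * (M * (N + 1)) + 1),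
      c i * tent N i (M * (N + 1)) x‖ ≤
      ε * ∑ i ∈ Finset.range (2 * (M + 1) + 1), tent 0 i (M + 1) x := by
    intro x
    have h1 : f x = ∑ i ∈ Finset.range (2 * (M * (N + 1)) + 1),
        f x * tent N i (M * (N + 1)) x := by
      rw [← Finset.mul_sum]
      by_cases h0 : f x = 0
      · rw [h0, zero_mul]
      · rw [sum_tent_eq_one (hM x h0), mul_one]
    have h2 : f x - ∑ i ∈ Finset.range (2 * (M * (N + 1)) + 1), c i * tent N i (M * (N + 1)) x =
        ∑ i ∈ Finset.range (2 * (M * (N + 1)) + 1), (f x - c i) * tent N i (M * (N + 1)) x := by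
      simp only [sub_mul, Finset.sum_sub_distrib]
      rw [← h1]
    rw [h2]
    refine (norm_sum_le _ _).trans (le_trans ?_
      (mul_le_mul_of_nonneg_left (sum_tent_le N M x) hε))
    rw [Finset.mul_sum]
    refine Finset.sum_le_sum fun i hi => ?_
    rw [Real.norm_eq_abs, abs_mul, abs_of_nonneg (tent_nonneg _ _ _ _)]
    rcases (tent_nonneg N i (M * (N + 1)) x).eq_or_lt with h | h
    · rw [← h, mul_zero, mul_zero]
    · exact mul_le_mul_of_nonneg_right (hc i (Finset.mem_range.1 hi) x h) h.le
  have hint : Integrable (fun x => ε * ∑ i ∈ Finset.range (2 * (M + 1) + 1),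
      tent 0 i (M + 1) x) m :=
    (integrable_finsetSum _ fun i _ => integrable_tent m _ _ _).const_mul _
  refine (norm_integral_le_of_norm_le hint (Eventually.of_forall hpt)).trans ?_
  rw [integral_const_mul, integral_finsetSum _ fun i _ => integrable_tent m _ _ _]
  exact mul_le_mul_of_nonneg_left hB hε

/-! ### Bounds read off from names -/

theorem le_encode_of_mem {L : List ℕ} {a : ℕ} (h : a ∈ L) : a ≤ Encodable.encode L := by
  induction L with
  | nil => simp at h
  | cons b L ih =>
    rw [Encodable.encode_list_cons]
    simp only [Encodable.encode_nat]
    rcases List.mem_cons.1 h with rfl | h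
    · exact (Nat.left_le_pair _ _).trans (Nat.le_succ _)
    · exact (ih h).trans ((Nat.right_le_pair _ _).trans (Nat.le_succ _))

theorem abs_le_of_mem_openInt {i : ℕ} {x : ℝ} (hx : x ∈ openInt i) : |x| ≤ 2 * i + 1 := by
  have h1 := abs_le.1 (abs_ratOf_le i.unpair.1)
  have h2 : (i.unpair.1 : ℝ) ≤ i := by exact_mod_cast Nat.unpair_left_le i
  have h3 : ((i.unpair.2.unpair.1 : ℕ) : ℝ) ≤ i := by
    exact_mod_cast (Nat.unpair_left_le _).trans (Nat.unpair_right_le i)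
  have h4 : (posRatOf i.unpair.2 : ℝ) ≤ i.unpair.2.unpair.1 + 1 := by
    rw [posRatOf]
    push_cast
    exact div_le_self (by positivity) (by linarith [(by positivity :
      (0 : ℝ) ≤ i.unpair.2.unpair.2)])
  have h5 := hx.1
  have h6 := hx.2
  rw [lo] at h5
  rw [hi, lo] at h6
  push_cast at h6
  exact abs_le.2 ⟨by linarith, by linarith⟩

/-- Each entry of the name codes a cover, and the code of the list dominates those of its members.
-/
theorem IsCompactName.abs_le {κ : ℕ → ℕ} {K : Set ℝ} (h : IsCompactName κ K) (n : ℕ) {x : ℝ}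
    (hx : x ∈ K) : |x| ≤ (2 * κ n + 1 : ℕ) := by
  have hn : IsMinCover (Denumerable.ofNat (List ℕ) (κ n)) K := by
    have : κ n ∈ Set.range κ := ⟨n, rfl⟩
    rwa [h] at this
  obtain ⟨i, hi, hxi⟩ := Set.mem_iUnion₂.1 (hn.1 hx)
  have h1 := le_encode_of_mem hi
  rw [Denumerable.encode_ofNat] at h1
  have h2 : (i : ℝ) ≤ κ n := by exact_mod_cast h1
  push_cast
  linarith [abs_le_of_mem_openInt hxi]

theorem exists_isFunName {f : ℝ → ℝ} (hf : Continuous f) : ∃ ρ, IsFunName ρ f := by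
  obtain ⟨J, hJ⟩ := exists_image_subset hf 0
  obtain ⟨ρ, hρ⟩ := (Set.to_countable
    {c : ℕ | f '' compactInt c.unpair.1 ⊆ openInt c.unpair.2}).exists_eq_range
    ⟨Nat.pair 0 J, by simpa using hJ⟩
  exact ⟨ρ, hρ.symm⟩

theorem exists_isCompactName {K : Set ℝ} (hK : IsCompact K) : ∃ κ, IsCompactName κ K := by
  have hne : ∃ L, IsMinCover L K := by
    rcases K.eq_empty_or_nonempty with rfl | ⟨x, hx⟩
    · exact ⟨[], by simp [IsMinCover]⟩
    · obtain ⟨R, hR⟩ := hK.isBounded.subset_ball 0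
      obtain ⟨n, hn⟩ := exists_nat_gt R
      obtain ⟨J, h1, h2⟩ := exists_lo_hi_eq (show (-(n + 1 : ℕ) : ℚ) < (n + 1 : ℕ) by
        have : (0 : ℚ) < (n + 1 : ℕ) := by positivity
        linarith)
      have hJ : K ⊆ openInt J := fun y hy => by
        have := hR hy
        rw [Metric.mem_ball, Real.dist_eq, sub_zero, abs_lt] at this
        rw [openInt, h1, h2]
        push_cast
        exact ⟨by linarith [this.1], by linarith [this.2]⟩
      exact ⟨[J], by simpa using hJ, by simpa using ⟨x, hJ hx, hx⟩⟩
  obtain ⟨L, hL⟩ := hne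
  obtain ⟨κ, hκ⟩ := (Set.to_countable
    {c : ℕ | IsMinCover (Denumerable.ofNat (List ℕ) c) K}).exists_eq_range
    ⟨Encodable.encode L, by simpa using hL⟩
  exact ⟨κ, hκ.symm⟩

theorem IsModulus.tendsto {g : ℕ → ℕ} {a : ℕ → ℝ} {l : ℝ} (h : IsModulus g a l) :
    Tendsto a atTop (𝓝 l) := by
  refine Metric.tendsto_atTop.2 fun ε hε => ?_
  obtain ⟨k, hk⟩ := exists_pow_lt_of_lt_one hε (show (2 : ℝ)⁻¹ < 1 by norm_num)
  exact ⟨g k, fun n hn => (h k n hn).trans hk⟩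

/-! ### Finding fine subdivisions from a name of a function -/

/-- The oracle segment `L` shows that the function varies by at most `1 / D` on the supports of the
tent functions of width `1 / (N + 1)` subdividing `[-M, M]`. -/
def FineAt (L : List ℕ) (M D N : ℕ) : Prop :=
  ∀ i < 2 * (M * (N + 1)) + 1, ∃ c ∈ L,
    ¬LtCode (ratCode i (M * (N + 1) + 1) N) c.unpair.1.unpair.1.unpair.1 ∧
    ¬LtCode (hiCode c.unpair.1.unpair.1) (ratCode (i + 1) (M * (N + 1)) N) ∧
    (c.unpair.1.unpair.2.unpair.2.unpair.1 + 1) * D ≤ c.unpair.1.unpair.2.unpair.2.unpair.2 + 1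

theorem primrecPred_fineAt {α : Type*} [Primcodable α] {L : α → List ℕ} {M D N : α → ℕ}
    (hL : Primrec L) (hM : Primrec M) (hD : Primrec D) (hN : Primrec N) :
    PrimrecPred fun a => FineAt (L a) (M a) (D a) (N a) := by
  unfold FineAt
  refine primrecPred_forall_lt (by fun_prop) (primrecPred_exists_mem (by fun_prop)
    (.and ?_ (.and ?_ ?_)))
  · exact (primrecPred_ltCode (by fun_prop) (by fun_prop)).not
  · exact (primrecPred_ltCode (by fun_prop) (by fun_prop)).not
  · exact primrecPred_le (by fun_prop) (by fun_prop)

theorem hi_sub_lo_le_iff {J D : ℕ} (hD : 0 < D) :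
    (J.unpair.2.unpair.1 + 1) * D ≤ J.unpair.2.unpair.2 + 1 ↔ (hi J : ℝ) - lo J ≤ 1 / D := by
  have hD' : (0 : ℝ) < D := by exact_mod_cast hD
  rw [hi, posRatOf]
  push_cast
  rw [add_sub_cancel_left, div_le_div_iff₀ (by positivity) hD', one_mul]
  exact_mod_cast Iff.rfl

/-- Take for `c i` the left endpoint of the listed interval `J`: it is within the length of `J` of
every value there, and bounded by the code of `L`. -/
theorem FineAt.exists_approx {L : List ℕ} {M D N : ℕ} (h : FineAt L M D N) (hD : 0 < D)
    {f : ℝ → ℝ} (hL : ∀ c ∈ L, f '' compactInt c.unpair.1.unpair.1 ⊆ openInt c.unpair.1.unpair.2) :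
    ∃ c : ℕ → ℝ, ∀ i < 2 * (M * (N + 1)) + 1, |c i| ≤ Encodable.encode L ∧
      ∀ x, 0 < tent N i (M * (N + 1)) x → |f x - c i| ≤ 1 / D := by
  choose! c hc using h
  refine ⟨fun i => lo (c i).unpair.1.unpair.2, fun i hi => ⟨?_, fun x hx => ?_⟩⟩
  · refine (abs_ratOf_le _).trans ?_
    exact_mod_cast ((Nat.unpair_left_le _).trans (Nat.unpair_right_le _)).trans
      ((Nat.unpair_left_le _).trans (le_encode_of_mem (hc i hi).1))
  · obtain ⟨h1, h2, h3, h4⟩ := hc i hi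
    rw [ltCode_iff_real, not_lt, ratOf_ratCode] at h2 h3
    rw [ratOf_hiCode] at h3
    push_cast at h2 h3
    rw [tent_pos_iff] at hx
    push_cast at hx
    have hxI : x ∈ compactInt (c i).unpair.1.unpair.1 :=
      ⟨h2.trans hx.1.le, hx.2.le.trans h3⟩
    have hfx := hL _ h1 ⟨x, hxI, rfl⟩
    have hw := (hi_sub_lo_le_iff hD).1 h4
    exact abs_le.2 ⟨by linarith [hfx.1, (by positivity : (0 : ℝ) ≤ 1 / D)], by linarith [hfx.2]⟩

/-- Uniform continuity gives `N`. The required interval pairs then occur somewhere in the name, and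
finitely many of them suffice. -/
theorem exists_fineAt {f : ℝ → ℝ} (hf : Continuous f) (hs : HasCompactSupport f) {ρ : ℕ → ℕ}
    (hρ : IsFunName ρ f) (κ : ℕ → ℕ) (M : ℕ) {D : ℕ} (hD : 0 < D) :
    ∃ N k, N < k ∧ FineAt ((List.range k).map (join ρ κ)) M D N := by
  have hD' : (0 : ℝ) < D := by exact_mod_cast hD
  have huc := hs.uniformContinuous_of_continuous hf
  obtain ⟨δ, hδ, hfδ⟩ := Metric.uniformContinuous_iff.1 huc (1 / (4 * D)) (by positivity)
  obtain ⟨N, hN⟩ := exists_nat_one_div_lt hδ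
  have hN0 : (0 : ℝ) < N + 1 := by positivity
  have hex : ∀ i, ∃ n,
      ¬LtCode (ratCode i (M * (N + 1) + 1) N) (ρ n).unpair.1.unpair.1 ∧
      ¬LtCode (hiCode (ρ n).unpair.1) (ratCode (i + 1) (M * (N + 1)) N) ∧
      ((ρ n).unpair.2.unpair.2.unpair.1 + 1) * D ≤ (ρ n).unpair.2.unpair.2.unpair.2 + 1 := by
    intro i
    have hlt : ratOf (ratCode i (M * (N + 1) + 1) N) < ratOf (ratCode (i + 1) (M * (N + 1)) N) := by
      rw [ratOf_ratCode, ratOf_ratCode]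
      push_cast
      exact div_lt_div_of_pos_right (by linarith) (by positivity)
    obtain ⟨I, hI1, hI2⟩ := exists_lo_hi_eq hlt
    set z : ℝ := ((i : ℝ) - M * (N + 1)) / (N + 1) with hz
    have h4 : (0 : ℝ) < 1 / (4 * D) := by positivity
    have h2 : (1 : ℝ) / (2 * D) = 1 / (4 * D) + 1 / (4 * D) := by field_simp; norm_num
    have h1 : (1 : ℝ) / D = 1 / (2 * D) + 1 / (2 * D) := by field_simp; norm_num
    -- `f` varies by less than `1 / (4 * D)` around `z`; rational endpoints at distance between `1 /
    -- (4 * D)` and `1 / (2 * D)` from `f z` keep the length of `J` below `1 / D`.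
    obtain ⟨u, hu1, hu2⟩ := exists_rat_btwn
      (show f z - 1 / (2 * D) < f z - 1 / (4 * D) by linarith)
    obtain ⟨v, hv1, hv2⟩ := exists_rat_btwn
      (show f z + 1 / (4 * D) < f z + 1 / (2 * D) by linarith)
    have huv : u < v := by
      have : (u : ℝ) < v := by linarith
      exact_mod_cast this
    obtain ⟨J, hJ1, hJ2⟩ := exists_lo_hi_eq huv
    have hIJ : f '' compactInt I ⊆ openInt J := by
      rintro _ ⟨x, hx, rfl⟩
      rw [compactInt, hI1, hI2, ratOf_ratCode, ratOf_ratCode] at hx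
      push_cast at hx
      have hx1 : z - 1 / (N + 1) ≤ x := by
        refine le_trans (le_of_eq ?_) hx.1
        rw [hz]; ring
      have hx2 : x ≤ z + 1 / (N + 1) := by
        refine hx.2.trans (le_of_eq ?_)
        rw [hz]; ring
      have hd : dist x z < δ := by
        rw [Real.dist_eq, abs_lt]
        exact ⟨by linarith, by linarith⟩
      have hfd := hfδ hd
      rw [Real.dist_eq, abs_lt] at hfd
      rw [openInt, hJ1, hJ2]
      exact ⟨by linarith [hfd.1], by linarith [hfd.2]⟩
    obtain ⟨n, hn⟩ : Nat.pair I J ∈ Set.range ρ := by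
      rw [hρ]
      simpa using hIJ
    refine ⟨n, ?_⟩
    rw [hn]
    simp only [Nat.unpair_pair]
    refine ⟨?_, ?_, (hi_sub_lo_le_iff hD).2 ?_⟩
    · rw [ltCode_iff, ← hI1]
      exact lt_irrefl _
    · rw [ltCode_iff, ratOf_hiCode, ← hI2]
      exact lt_irrefl _
    · rw [hJ1, hJ2]
      linarith
  choose n hn using hex
  -- The segment must contain all the entries found and also be longer than `N`, since `findFine`
  -- searches only up to the length of the segment.
  refine ⟨N, N + 1 + ∑ i ∈ Finset.range (2 * (M * (N + 1)) + 1), (n i + 1), by omega,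
    fun i hi => ⟨join ρ κ (n i), List.mem_map.2 ⟨n i, List.mem_range.2 ?_, rfl⟩, ?_⟩⟩
  · have := Finset.single_le_sum (f := fun i => n i + 1) (fun _ _ => Nat.zero_le _)
      (Finset.mem_range.2 hi)
    omega
  · simpa only [join, Nat.unpair_pair] using hn i

/-! ### The Turing functional computing moduli of convergence -/

/-- The maximum of `g 0, …, g (n - 1)`, and `0` for `n = 0`. -/
def maxBelow (g : ℕ → ℕ) (n : ℕ) : ℕ := Nat.rec 0 (fun i m => max m (g i)) n

theorem le_maxBelow {g : ℕ → ℕ} {n i : ℕ} (hi : i < n) : g i ≤ maxBelow g n := by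
  induction n with
  | zero => omega
  | succ n ih =>
    rcases Nat.lt_succ_iff_lt_or_eq.1 hi with h | rfl
    · exact (ih h).trans (le_max_left _ _)
    · exact le_max_right _ _

theorem computable_maxBelow {α : Type*} [Primcodable α] {g : α → ℕ → ℕ} {f : α → ℕ}
    (hf : Computable f) (hg : Computable₂ g) : Computable fun a => maxBelow (g a) (f a) := by
  have h : Computable₂ fun (a : α) (q : ℕ × ℕ) => max q.2 (g a q.1) :=
    Primrec.nat_max.to_comp.comp (Primrec.to_comp (by fun_prop))
      (hg.comp Computable.fst (Primrec.to_comp (by fun_prop)))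
  exact Computable.nat_rec hf (Computable.const 0) h

open Classical in
/-- One more than an `N` at which the oracle segment `L` is fine, or `0` if none is found. -/
noncomputable def findFine (L : List ℕ) (M D : ℕ) : ℕ :=
  -- `Nat.findGreatest` also returns `0` when nothing is found, hence the second test.
  if FineAt L M D (Nat.findGreatest (FineAt L M D) L.length) then
    Nat.findGreatest (FineAt L M D) L.length + 1 else 0

theorem fineAt_of_findFine {L : List ℕ} {M D N : ℕ} (h : findFine L M D = N + 1) :
    FineAt L M D N := by
  unfold findFine at h
  split_ifs at h with hf
  obtain rfl := Nat.succ_injective h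
  exact hf

theorem findFine_ne_zero {L : List ℕ} {M D N : ℕ} (hN : N < L.length) (h : FineAt L M D N) :
    findFine L M D ≠ 0 := by
  classical
  have := Nat.findGreatest_spec (P := FineAt L M D) hN.le h
  unfold findFine
  rw [if_pos (by convert this)]
  exact Nat.succ_ne_zero _

theorem primrec_findFine :
    Primrec fun a : List ℕ × ℕ × ℕ => findFine a.1 a.2.1 a.2.2 := by
  classical
  have h : PrimrecRel fun (a : List ℕ × ℕ × ℕ) (N : ℕ) => FineAt a.1 a.2.1 a.2.2 N :=
    primrecPred_fineAt (by fun_prop) (by fun_prop) (by fun_prop) (by fun_prop)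
  have hg : Primrec fun a : List ℕ × ℕ × ℕ =>
      Nat.findGreatest (FineAt a.1 a.2.1 a.2.2) a.1.length :=
    Primrec.nat_findGreatest (by fun_prop) h
  refine (Primrec.ite (h.comp Primrec.id hg) (primrec_add hg (Primrec.const 1))
    (Primrec.const 0)).of_eq fun a => ?_
  unfold findFine
  congr

section Functional

variable (m : ℕ → ℕ → ℕ) (b : ℕ → ℕ)

/-- A time after which the integrals of the unit tent functions on `[-(M + 1), M + 1]` are within
`1` of their limits. -/
def startTime (M : ℕ) : ℕ :=
  maxBelow (fun i => m (Nat.pair 0 (Nat.pair i (M + 1))) 0) (2 * (M + 1) + 1)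

/-- A bound on the integrals of the sum of these tent functions after that time. -/
def massBound (M : ℕ) : ℕ := (2 * (M + 1) + 1) * (b (startTime m M) + 2)

/-- Makes the mass bound times the tolerance at most `2⁻¹ ^ (k + 2)`; the `+ 1` keeps it positive.
-/
def inverseTolerance (M k : ℕ) : ℕ := (massBound m b M + 1) * 2 ^ (k + 2)

theorem inverseTolerance_pos (M k : ℕ) : 0 < inverseTolerance m b M k :=
  Nat.mul_pos (Nat.succ_pos _) (Nat.two_pow_pos _)

def tentTime (M N K : ℕ) : ℕ :=
  maxBelow (fun i => m (Nat.pair N (Nat.pair i (M * (N + 1)))) K) (2 * (M * (N + 1)) + 1)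

variable {m} in
theorem le_tentTime {M N K i : ℕ} (hi : i < 2 * (M * (N + 1)) + 1) :
    m (Nat.pair N (Nat.pair i (M * (N + 1)))) K ≤ tentTime m M N K :=
  le_maxBelow (g := fun i => m (Nat.pair N (Nat.pair i (M * (N + 1)))) K) hi

variable {m} in
theorem le_startTime {M i : ℕ} (hi : i < 2 * (M + 1) + 1) :
    m (Nat.pair 0 (Nat.pair i (M + 1))) 0 ≤ startTime m M :=
  le_maxBelow (g := fun i => m (Nat.pair 0 (Nat.pair i (M + 1))) 0) hi

/-- The precision to which the integrals of the tent functions have to be known for a linear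
combination, with coefficients bounded by the code of `L`, to be known up to `2⁻¹ ^ (k + 2)`. -/
def precision (L : List ℕ) (M N k : ℕ) : ℕ :=
  (2 * (M * (N + 1)) + 1) * Encodable.encode L + (k + 2)

/-- The radius of an interval containing the support, read off from an oracle segment. -/
def supportBound (L : List ℕ) : ℕ := 2 * (L.getD 0 0).unpair.2 + 1

/-- One more than a modulus of convergence at `k`, or `0` if the oracle segment is too short. -/
noncomputable def modulusStep (L : List ℕ) (k : ℕ) : ℕ :=
  Nat.casesOn (findFine L (supportBound L) (inverseTolerance m b (supportBound L) k)) 0 fun N =>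
    max (startTime m (supportBound L)) (tentTime m (supportBound L) N
      (precision L (supportBound L) N k)) + 1

variable {m b}

theorem computable_startTime (hm : Computable₂ m) : Computable (startTime m) :=
  computable_maxBelow (Primrec.to_comp (by fun_prop))
    (hm.comp (Primrec.to_comp (by fun_prop)) (Computable.const 0))

theorem computable_inverseTolerance (hm : Computable₂ m) (hb : Computable b) :
    Computable₂ (inverseTolerance m b) := by
  have h : Primrec fun q : (ℕ × ℕ) × ℕ =>
      ((2 * (q.1.1 + 1) + 1) * (q.2 + 2) + 1) * 2 ^ (q.1.2 + 2) := by fun_prop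
  have hc : Computable fun q : ℕ × ℕ => (q, b (startTime m q.1)) :=
    Computable.id.pair (hb.comp ((computable_startTime hm).comp Computable.fst))
  exact (h.to_comp.comp hc).of_eq fun q => by simp only [inverseTolerance, massBound]

theorem computable_tentTime (hm : Computable₂ m) :
    Computable fun q : ℕ × ℕ × ℕ => tentTime m q.1 q.2.1 q.2.2 :=
  computable_maxBelow (Primrec.to_comp (by fun_prop))
    (hm.comp (Primrec.to_comp (by fun_prop)) (Primrec.to_comp (by fun_prop)))

theorem primrec_supportBound : Primrec supportBound := by unfold supportBound; fun_prop

theorem computable_findFine_comp (hm : Computable₂ m) (hb : Computable b) :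
    Computable fun q : List ℕ × ℕ =>
      findFine q.1 (supportBound q.1) (inverseTolerance m b (supportBound q.1) q.2) := by
  have hM : Primrec fun q : List ℕ × ℕ => supportBound q.1 := primrec_supportBound.comp Primrec.fst
  have htol : Computable fun q : List ℕ × ℕ => inverseTolerance m b (supportBound q.1) q.2 :=
    (computable_inverseTolerance hm hb).comp hM.to_comp Computable.snd
  have hargs : Computable fun q : List ℕ × ℕ =>
      (q.1, supportBound q.1, inverseTolerance m b (supportBound q.1) q.2) :=
    Computable.fst.pair (hM.to_comp.pair htol)
  have h := primrec_findFine.to_comp.comp hargs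
  exact h

theorem computable_tentTime_comp (hm : Computable₂ m) :
    Computable fun q : (List ℕ × ℕ) × ℕ => tentTime m (supportBound q.1.1) q.2
      (precision q.1.1 (supportBound q.1.1) q.2 q.1.2) := by
  have hM : Primrec fun q : (List ℕ × ℕ) × ℕ => supportBound q.1.1 :=
    primrec_supportBound.comp (Primrec.fst.comp Primrec.fst)
  have hK : Primrec fun q : (List ℕ × ℕ) × ℕ =>
      precision q.1.1 (supportBound q.1.1) q.2 q.1.2 := by
    unfold precision
    fun_prop
  have hargs : Computable fun q : (List ℕ × ℕ) × ℕ => (supportBound q.1.1, q.2,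
      precision q.1.1 (supportBound q.1.1) q.2 q.1.2) :=
    hM.to_comp.pair (Computable.snd.pair hK.to_comp)
  have h := (computable_tentTime hm).comp hargs
  exact h

theorem computable_modulusStep (hm : Computable₂ m) (hb : Computable b) :
    Computable fun q : List ℕ × ℕ => modulusStep m b q.1 q.2 := by
  have hM : Primrec fun q : (List ℕ × ℕ) × ℕ => supportBound q.1.1 :=
    primrec_supportBound.comp (Primrec.fst.comp Primrec.fst)
  have hstep : Computable fun q : (List ℕ × ℕ) × ℕ =>
      max (startTime m (supportBound q.1.1)) (tentTime m (supportBound q.1.1) q.2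
        (precision q.1.1 (supportBound q.1.1) q.2 q.1.2)) + 1 :=
    Primrec.nat_add.to_comp.comp (Primrec.nat_max.to_comp.comp
      ((computable_startTime hm).comp hM.to_comp) (computable_tentTime_comp hm))
      (Computable.const 1)
  unfold modulusStep
  exact Computable.nat_casesOn (computable_findFine_comp hm hb) (Computable.const 0) hstep.to₂

/-- At the start time each unit tent has integral at most the total mass, hence at most `b`. Its
limit is then at most `b + 1`, and all later integrals at most `b + 2`. -/
theorem startTime_bounds {μ : ℕ → Measure ℝ} [∀ n, IsFiniteMeasure (μ n)] {ν : Measure ℝ}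
    (hmod : ∀ N i c, IsModulus (m (Nat.pair N (Nat.pair i c)))
      (fun n => ∫ x, tent N i c x ∂(μ n)) (∫ x, tent N i c x ∂ν))
    (hb : ∀ n, (μ n).real Set.univ ≤ b n) (M : ℕ) :
    ∑ i ∈ Finset.range (2 * (M + 1) + 1), ∫ x, tent 0 i (M + 1) x ∂ν ≤ massBound m b M ∧
    ∀ n ≥ startTime m M,
      ∑ i ∈ Finset.range (2 * (M + 1) + 1), ∫ x, tent 0 i (M + 1) x ∂(μ n) ≤ massBound m b M := by
  have key : ∀ i < 2 * (M + 1) + 1, ∀ n ≥ startTime m M,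
      |∫ x, tent 0 i (M + 1) x ∂(μ n) - ∫ x, tent 0 i (M + 1) x ∂ν| < 1 := fun i hi n hn => by
    simpa using hmod 0 i (M + 1) 0 n ((le_startTime hi).trans hn)
  have hstart : ∀ i, ∫ x, tent 0 i (M + 1) x ∂(μ (startTime m M)) ≤ b (startTime m M) := fun i => by
    refine le_trans ?_ (hb _)
    refine (integral_mono (integrable_tent _ _ _ _) (integrable_const 1)
      (tent_le_one 0 i (M + 1))).trans ?_
    simp
  have hν : ∀ i < 2 * (M + 1) + 1, ∫ x, tent 0 i (M + 1) x ∂ν ≤ b (startTime m M) + 1 :=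
    fun i hi => by linarith [(abs_lt.1 (key i hi _ le_rfl)).1, hstart i]
  have hsum : ∀ u : ℕ → ℝ, (∀ i < 2 * (M + 1) + 1, u i ≤ b (startTime m M) + 2) →
      ∑ i ∈ Finset.range (2 * (M + 1) + 1), u i ≤ massBound m b M := fun u hu => by
    refine (Finset.sum_le_card_nsmul _ _ _ fun i hi => hu i (Finset.mem_range.1 hi)).trans ?_
    rw [Finset.card_range, nsmul_eq_mul, massBound]
    push_cast
    exact le_rfl
  exact ⟨hsum _ fun i hi => by linarith [hν i hi],
    fun n hn => hsum _ fun i hi => by linarith [hν i hi, (abs_lt.1 (key i hi n hn)).2]⟩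

/-- Any output of the functional on a segment of a name is correct. -/
theorem abs_integral_sub_lt_of_modulusStep {μ : ℕ → Measure ℝ} [∀ n, IsFiniteMeasure (μ n)]
    {ν : Measure ℝ} [IsLocallyFiniteMeasure ν]
    (hmod : ∀ N i c, IsModulus (m (Nat.pair N (Nat.pair i c)))
      (fun n => ∫ x, tent N i c x ∂(μ n)) (∫ x, tent N i c x ∂ν))
    (hb : ∀ n, (μ n).real Set.univ ≤ b n) {f : ℝ → ℝ} (hf : Continuous f)
    (hs : HasCompactSupport f) {L : List ℕ} {k v : ℕ} (hv : modulusStep m b L k = v + 1)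
    (hM : ∀ x, f x ≠ 0 → |x| ≤ supportBound L)
    (hL : ∀ c ∈ L, f '' compactInt c.unpair.1.unpair.1 ⊆ openInt c.unpair.1.unpair.2)
    {n : ℕ} (hn : v ≤ n) : |∫ x, f x ∂(μ n) - ∫ x, f x ∂ν| < (2 : ℝ)⁻¹ ^ k := by
  unfold modulusStep at hv
  set M := supportBound L
  rcases hN : findFine L M (inverseTolerance m b M k) with _ | N
  · simp [hN] at hv
  rw [hN] at hv
  have hfine := fineAt_of_findFine hN
  have hD : 0 < inverseTolerance m b M k := inverseTolerance_pos m b M k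
  have hv' := (Nat.succ_injective hv).le.trans hn
  obtain ⟨hn1, hn2⟩ := max_le_iff.1 hv'
  obtain ⟨c, hc⟩ := hfine.exists_approx hD hL
  obtain ⟨hBν, hBμ⟩ := startTime_bounds hmod hb M
  have hD2 : ((inverseTolerance m b M k : ℕ) : ℝ) =
      (((massBound m b M : ℕ) : ℝ) + 1) * (2 ^ k * 4) := by
    simp only [inverseTolerance]
    push_cast
    rw [pow_add]
    norm_num
  have hB0 : (0 : ℝ) ≤ ((massBound m b M : ℕ) : ℝ) := Nat.cast_nonneg _
  generalize ((massBound m b M : ℕ) : ℝ) = B at *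
  generalize ((inverseTolerance m b M k : ℕ) : ℝ) = D at *
  have hp : (0 : ℝ) < 2⁻¹ ^ k := by positivity
  have hD0 : 0 ≤ 1 / D := by rw [hD2]; positivity
  have hDB : 1 / D * B ≤ 2⁻¹ ^ k / 4 := by
    rw [hD2, one_div_mul_eq_div, inv_pow, div_le_iff₀ (by positivity)]
    field_simp
    linarith
  -- The error splits into three parts, each at most a quarter of `2⁻¹ ^ k`: replacing `f` by the
  -- tent combination under `μ n` and under `ν`, and the convergence of that combination.
  have h1 := (abs_integral_sub_sum_le (μ n) hf hs hM hD0
    (fun i hi => (hc i hi).2) (hBμ n hn1)).trans hDB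
  have h2 := (abs_integral_sub_sum_le ν hf hs hM hD0
    (fun i hi => (hc i hi).2) hBν).trans hDB
  set R := 2 * (M * (N + 1)) + 1
  have h3 : |∑ i ∈ Finset.range R, c i * ∫ x, tent N i (M * (N + 1)) x ∂(μ n) -
      ∑ i ∈ Finset.range R, c i * ∫ x, tent N i (M * (N + 1)) x ∂ν| ≤ 2⁻¹ ^ k / 4 := by
    rw [← Finset.sum_sub_distrib]
    refine (Finset.abs_sum_le_sum_abs _ _).trans ?_
    have hterm : ∀ i ∈ Finset.range R, |c i * ∫ x, tent N i (M * (N + 1)) x ∂(μ n) -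
        c i * ∫ x, tent N i (M * (N + 1)) x ∂ν| ≤
        Encodable.encode L * 2⁻¹ ^ precision L M N k := fun i hi => by
      rw [← mul_sub, abs_mul]
      have hi' := Finset.mem_range.1 hi
      exact mul_le_mul (hc i hi').1
        (hmod N i (M * (N + 1)) _ n ((le_tentTime hi').trans hn2)).le
        (abs_nonneg _) (Nat.cast_nonneg _)
    refine (Finset.sum_le_card_nsmul _ _ _ hterm).trans ?_
    rw [Finset.card_range, nsmul_eq_mul, ← mul_assoc, precision, pow_add, pow_add _ k 2, ← mul_assoc]
    -- The exponent in `precision` absorbs the number of terms times the coefficient bound, since `x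
    -- < 2 ^ x`.
    have hX : ((R : ℝ) * Encodable.encode L) * 2⁻¹ ^ (R * Encodable.encode L) ≤ 1 := by
      rw [inv_pow, mul_inv_le_iff₀ (by positivity), one_mul]
      exact_mod_cast (Nat.lt_two_pow_self (n := R * Encodable.encode L)).le
    refine (mul_le_mul_of_nonneg_right hX (by positivity)).trans (le_of_eq ?_)
    ring
  rw [abs_le] at h1 h2 h3
  exact abs_lt.2 ⟨by linarith [h1.1, h2.2, h3.1], by linarith [h1.2, h2.1, h3.2]⟩

end Functional

theorem EffectiveVagueTendsto.uniformEffectiveVagueTendsto {μ : ℕ → Measure ℝ}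
    [∀ n, IsFiniteMeasure (μ n)] (hμ : UniformlyComputable μ) {ν : Measure ℝ}
    [IsLocallyFiniteMeasure ν] (h : EffectiveVagueTendsto μ ν) :
    UniformEffectiveVagueTendsto μ ν := by
  obtain ⟨m, hm, hm'⟩ := h.exists_tent_modulus
  obtain ⟨b, hb, hb'⟩ := hμ.exists_bound
  have hmod : ∀ N i c, IsModulus (m (Nat.pair N (Nat.pair i c)))
      (fun n => ∫ x, tent N i c x ∂(μ n)) (∫ x, tent N i c x ∂ν) := fun N i c => by
    simpa only [Nat.unpair_pair] using hm' (Nat.pair N (Nat.pair i c))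
  obtain ⟨e, -, he⟩ := exists_functional_param (F := fun _ L k => modulusStep m b L k)
    ((computable_modulusStep hm hb).comp Computable.snd)
  have huniform : ∀ f : ℝ → ℝ, Continuous f → HasCompactSupport f →
      ∀ ρ κ : ℕ → ℕ, IsFunName ρ f → IsCompactName κ (tsupport f) →
        ∃ g, FunctionalComputes (e 0) (join ρ κ) g ∧
          IsModulus g (fun n => ∫ x, f x ∂(μ n)) (∫ x, f x ∂ν) := by
    intro f hf hs ρ κ hρ hκ
    let seg : ℕ → List ℕ := fun j => (List.range j).map (join ρ κ)
    have hseg : ∀ j, 0 < j → supportBound (seg j) = 2 * κ 0 + 1 := fun j hj => by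
      simp [seg, supportBound, List.getD_eq_getElem?_getD, hj, join]
    have hex : ∀ k, ∃ j, modulusStep m b (seg j) k ≠ 0 := by
      intro k
      obtain ⟨N, j, hNj, hfine⟩ := exists_fineAt hf hs hρ κ (2 * κ 0 + 1)
        (inverseTolerance_pos m b (2 * κ 0 + 1) k)
      refine ⟨j, ?_⟩
      have hne := findFine_ne_zero (L := seg j) (by simpa [seg] using hNj) hfine
      obtain ⟨N', hN'⟩ := Nat.exists_eq_succ_of_ne_zero hne
      unfold modulusStep
      rw [hseg j (by omega), hN']
      exact Nat.succ_ne_zero _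
    classical
    have hspec := fun k => Nat.find_spec (hex k)
    choose g hg using fun k => Nat.exists_eq_succ_of_ne_zero (hspec k)
    refine ⟨g, fun k => he 0 (join ρ κ) k (g k) (Nat.find (hex k)) (hg k)
      fun j hj => not_not.1 (Nat.find_min (hex k) hj), fun k n hn => ?_⟩
    -- The empty segment would supply a default support bound, but it is never fine, as the tent `i
    -- = 0` needs a listed pair. So every output uses the true entry `κ 0`.
    have hpos : 0 < Nat.find (hex k) := by
      by_contra! h0
      have h1 := hg k
      rw [Nat.le_zero.1 h0] at h1
      obtain ⟨N, hN⟩ : ∃ N, findFine (seg 0) (supportBound (seg 0))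
          (inverseTolerance m b (supportBound (seg 0)) k) = N + 1 := by
        refine Nat.exists_eq_succ_of_ne_zero fun h2 => ?_
        simp [modulusStep, h2] at h1
      obtain ⟨c, hc, -⟩ := fineAt_of_findFine hN 0 (by omega)
      simp [seg] at hc
    refine abs_integral_sub_lt_of_modulusStep hmod hb' hf hs (hg k) (fun x hx => ?_)
      (fun c hc => ?_) hn
    · rw [hseg _ hpos]
      exact hκ.abs_le 0 (subset_tsupport f hx)
    · obtain ⟨j, -, rfl⟩ := List.mem_map.1 hc
      have : ρ j ∈ Set.range ρ := ⟨j, rfl⟩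
      rw [hρ] at this
      simpa [join] using this
  refine ⟨fun f hf hs => ?_, e 0, huniform⟩
  obtain ⟨ρ, hρ⟩ := exists_isFunName hf
  obtain ⟨κ, hκ⟩ := exists_isCompactName hs.isCompact
  obtain ⟨g, -, hg⟩ := huniform f hf hs ρ κ hρ hκ
  exact hg.tendsto

end EffVague

theorem theorem5p1 (μ : ℕ → MeasureTheory.Measure ℝ)
    [∀ n, MeasureTheory.IsFiniteMeasure (μ n)]
    (hμ : EffVague.UniformlyComputable μ)
    (ν : MeasureTheory.Measure ℝ) [MeasureTheory.IsLocallyFiniteMeasure ν] :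
    EffVague.EffectiveVagueTendsto μ ν ↔ EffVague.UniformEffectiveVagueTendsto μ ν :=
  ⟨fun h => h.uniformEffectiveVagueTendsto hμ, fun h => h.effectiveVagueTendsto⟩
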